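/- Let $\Sigma=\{f_1,\dots,f_K\}$ be a finite signature containing at least one constant, let $N$ be the maximal arity of a symbol of $\Sigma$, let $\mathcal T$ be the set of terms over $\Sigma$ and a set of variables, and let $\mathcal T_0$ be the set of ground terms. The depth of variables and constants is $0$, and $\mathrm{depth}(f(s_1,\dots,s_m))=1+\max_i\mathrm{depth}(s_i)$ for $m>0$. The lexicographic path order $\succ$ on $\mathcal T$ (with $f_j$ above $f_i$ iff $j>i$) is given by: $s\succ t$ iff either $t$ is a variable occurring in $s$ and $s\neq t$, or $s=f_j(s_1,\dots,s_m)$, $t=f_i(t_1,\dots,t_n)$ and (a) $s_k\succeq t$ for some $k$, or (b) $j>i$ and $s\succ t_l$ for all $l$, or (c) $i=j$, $s\succ t_l$ for all $l$, and for some $i_0$, $s_l=t_l$ for all $l<i_0$ and $s_{i_0}\succ t_{i_0}$. *Ordinal terms.* The set $T$, its subset $P$ and the order $>$ on $T$ are defined simultaneously. $T$ consists of the formal sums $\alpha_1+\dots+\alpha_m$ ($m\ge 0$, the empty sum being $0$) with $\alpha_1\ge\dots\ge\alpha_m$ in $P$, and $P$ consists of the terms $\psi(\alpha_1,\dots,\alpha_{N+1})$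 with $\alpha_i\in T$. Sums are compared lexicographically, a proper initial segment of a sum being smaller than the sum. Further, $\psi(\bar\alpha)>\psi(\bar\beta)$ iff $\alpha_k\ge\psi(\bar\beta)$ for some $k$, or $\psi(\bar\alpha)>\beta_l$ for all $l$ and $\bar\alpha>_{\mathrm{lex}}\bar\beta$. Put $1=\psi(0,\dots,0)$, and let $n\in\mathbb N$ also denote $1+\dots+1$ ($n$ times). A limit is a term that is neither $0$ nor of the form $\alpha+1$. The natural sum $\alpha\#\beta$ is the non-increasing sum of all summands of $\alpha$ and $\beta$. *Fundamental sequences.* For $\bar\alpha=(\alpha_1,\dots,\alpha_N)$ let $\mathrm{Fix}(\bar\alpha)$ be the set of all $\psi(\bar\gamma,\delta)$ with $\bar\gamma>_{\mathrm{lex}}\bar\alpha$ and $\psi(\bar\gamma,\delta)>\alpha_i$ for all $i\le N$. Let $\mathrm{IS}_{\bar\alpha}(0)=\emptyset$ and $\mathrm{IS}_{\bar\alpha}(\gamma_1+\dots+\gamma_m)=\bigcup_i\mathrm{IS}_{\bar\alpha}(\gamma_i)$; let $\mathrm{IS}_{\bar\alpha}(\psi(\gamma_1,\dots,\gamma_{N+1}))$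 be $\{\psi(\gamma_1,\dots,\gamma_{N+1})\}$ if $(\gamma_1,\dots,\gamma_N)\ge_{\mathrm{lex}}\bar\alpha$, and $\bigcup_{i\le N+1}\mathrm{IS}_{\bar\alpha}(\gamma_i)$ otherwise. Let $\mathrm{MS}(\bar\alpha)$ be the maximum of $\bigcup_{i\le N}\mathrm{IS}_{\bar\alpha}(\alpha_i)$, or $0$ if this set is empty. For $x\in\mathbb N$ put $0[x]=0$ and $(\alpha_1+\dots+\alpha_m)[x]=\alpha_1+\dots+\alpha_m[x]$ for $m>1$. For $\psi(\bar\alpha,\beta)[x]$, with $\bar\alpha=(\alpha_1,\dots,\alpha_N)$, the rules are the following. - In all cases, if $\beta$ is a limit not in $\mathrm{Fix}(\bar\alpha)$, then $\psi(\bar\alpha,\beta)[x]=\psi(\bar\alpha,\beta[x])$. - If $\bar\alpha=\bar 0$: $\psi(\bar 0,0)[x]=0$; $\psi(\bar 0,\beta'+1)[x]=\psi(\bar 0,\beta')\cdot(x+1)$; and $\psi(\bar 0,\beta)[x]=\beta\cdot(x+1)$ for a limit $\beta\in\mathrm{Fix}(\bar 0)$. - If the last nonzero entry of $\bar\alpha$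 is $\alpha_i=\alpha'+1$, let $g(z)=\psi(\alpha_1,\dots,\alpha_{i-1},\alpha',z,0,\dots,0)$. The value is $g^{x+1}(0)$ for $\beta=0$; $g^{x+1}(\psi(\bar\alpha,\beta'))$ for $\beta=\beta'+1$; and $g^{x+1}(\beta)$ for a limit $\beta\in\mathrm{Fix}(\bar\alpha)$. - If the last nonzero entry $\alpha_i$ of $\bar\alpha$ is a limit, let $h(z)=\psi(\alpha_1,\dots,\alpha_{i-1},\alpha_i[x],0,\dots,0,z)$. The value is $h(\mathrm{MS}(\bar\alpha))$ for $\beta=0$; $h(\psi(\bar\alpha,\beta'))$ for $\beta=\beta'+1$; and $h(\beta)$ for a limit $\beta\in\mathrm{Fix}(\bar\alpha)$. *Pointwise descent.* For $x\in\mathbb N$ define finite sets $(\alpha)^x\subseteq T$ by recursion. $(0)^x=\emptyset$. For $m>1$, $(\alpha_1+\dots+\alpha_m)^x$ consists of all $\alpha_i$ and all $\alpha_1\#\cdots\#\alpha_i^*\#\cdots\#\alpha_m$ with $\alpha_i^*\in(\alpha_i)^x$. The set $(\psi(\bar\alpha))^x$ consists of all $\psi(\alpha_1,\dots,\alpha_i^*,\dots,\alpha_{N+1})$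 with $\alpha_i^*\in(\alpha_i)^x$, all $\alpha_i+x$ with $\alpha_i>0$, and $\psi(\bar\alpha)[x]$. Let $>_x$ be the transitive closure of the relation $\{(\alpha,\beta):\beta\in(\alpha)^x\}$ on $T$. *Interpretation.* Define $I:\mathcal T_0\to T$ by $I(f_j)=\psi(j,0,\dots,0)$ for a constant $f_j$ and $I(f_j(s_1,\dots,s_m))=\psi(j,I(s_1),\dots,I(s_{m-1}),I(s_m)+1,0,\dots,0)$ for $m>0$. **Theorem (Interpretation Theorem).** Let $R$ be a finite rewrite system over $\mathcal T$ whose rewrite relation $\to_R$ (the least relation that contains $R$ and is closed under substitutions and contexts) is contained in $\succ$. Then there is $k\in\mathbb N$, namely $k=2\max\{\mathrm{depth}(r):(l,r)\in R\}$ (read as $0$ if $R=\emptyset$), such that for all terms $l,r\in\mathcal T$ with $l\to_R r$ and all ground substitutions $\rho$, $$I(l\rho)>_k I(r\rho).$$ -/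

import Mathlib

/-! ## Terms, rewriting, and the lexicographic path order

The signature is `f_1, …, f_K`, given by an arity function `ar : Fin K → ℕ`; the index
`j : Fin K` stands for the symbol `f_(j+1)`. -/

/-- First-order terms over the signature `ar` with variables in `V`. Ground terms are the terms
over the empty set of variables, `RTerm ar Empty`. -/
inductive RTerm {K : ℕ} (ar : Fin K → ℕ) (V : Type*) : Type _
  | var : V → RTerm ar V
  | app : (f : Fin K) → (Fin (ar f) → RTerm ar V) → RTerm ar V

namespace RTerm

variable {K : ℕ} {ar : Fin K → ℕ} {V W : Type*}

/-- Application of the substitution `σ` to a term. -/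
def subst (σ : V → RTerm ar W) : RTerm ar V → RTerm ar W
  | var x => σ x
  | app f ts => app f (fun i => (ts i).subst σ)

/-- Term depth: variables and constants have depth `0`, and otherwise the depth is
`max {depth of the arguments} + 1`. -/
def depth : RTerm ar V → ℕ
  | var _ => 0
  | app _ ts => Finset.univ.sup (fun i => (ts i).depth + 1)

/-- The set of variables of a term. -/
def vars : RTerm ar V → Set V
  | var x => {x}
  | app _ ts => ⋃ i, (ts i).vars

/-- The lexicographic path order `s ≻ t` for the precedence `f_j ≻ f_i ↔ j > i`. -/
inductive LPO : RTerm ar V → RTerm ar V → Prop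
  | var {s : RTerm ar V} {x : V} : x ∈ s.vars → s ≠ var x → LPO s (var x)
  | subEq {f g : Fin K} {ss : Fin (ar f) → RTerm ar V} {ts : Fin (ar g) → RTerm ar V}
      (k : Fin (ar f)) : ss k = app g ts → LPO (app f ss) (app g ts)
  | subGt {f g : Fin K} {ss : Fin (ar f) → RTerm ar V} {ts : Fin (ar g) → RTerm ar V}
      (k : Fin (ar f)) : LPO (ss k) (app g ts) → LPO (app f ss) (app g ts)
  | prec {f g : Fin K} {ss : Fin (ar f) → RTerm ar V} {ts : Fin (ar g) → RTerm ar V} :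
      g < f → (∀ l, LPO (app f ss) (ts l)) → LPO (app f ss) (app g ts)
  | lex {f : Fin K} {ss ts : Fin (ar f) → RTerm ar V} (i₀ : Fin (ar f)) :
      (∀ l, LPO (app f ss) (ts l)) → (∀ l, l < i₀ → ss l = ts l) → LPO (ss i₀) (ts i₀) →
      LPO (app f ss) (app f ts)

/-- The rewrite relation of `R`: the least relation that contains `R` and is closed under
substitutions and contexts. -/
inductive Rew (R : Finset (RTerm ar V × RTerm ar V)) : RTerm ar V → RTerm ar V → Prop
  | rule {l r : RTerm ar V} : (l, r) ∈ R → Rew R l r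
  | subst {s t : RTerm ar V} (σ : V → RTerm ar V) : Rew R s t → Rew R (s.subst σ) (t.subst σ)
  | ctx {f : Fin K} (ss : Fin (ar f) → RTerm ar V) (i : Fin (ar f)) {t : RTerm ar V} :
      Rew R (ss i) t → Rew R (app f ss) (app f (Function.update ss i t))

/-- `max {depth r | (l, r) ∈ R}` (and `0` for the empty system). -/
def maxRhsDepth (R : Finset (RTerm ar V × RTerm ar V)) : ℕ :=
  R.sup (fun p => p.2.depth)

/-- The maximal arity of a function symbol. -/
def maxArity (ar : Fin K → ℕ) : ℕ := Finset.univ.sup ar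

end RTerm

/-! ## Ordinal terms -/

/-- Formal sums of `ψ`-terms, without any condition on the order of the summands:
`add a r` stands for `ψ(a_1, …, a_(N+1)) + r`. The set `T` of ordinal terms is carved out of
these by `OTerm.NF` below. -/
inductive OTerm (N : ℕ) : Type
  | zero : OTerm N
  | add : (Fin (N + 1) → OTerm N) → OTerm N → OTerm N

namespace OTerm

variable {N : ℕ}

/-- `ψ(a_1, …, a_(N+1))` -/
def psi (a : Fin (N + 1) → OTerm N) : OTerm N := add a zero

/-- `1 = ψ(0, …, 0)` -/
def one : OTerm N := psi (fun _ => zero)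

/-- `(α_1 + ⋯ + α_m) + (β_1 + ⋯ + β_n) = α_1 + ⋯ + α_m + β_1 + ⋯ + β_n` -/
def plus : OTerm N → OTerm N → OTerm N
  | zero, β => β
  | add a r, β => add a (plus r β)

/-- `α · n = α + ⋯ + α` -/
def mul (α : OTerm N) : ℕ → OTerm N
  | 0 => zero
  | n + 1 => plus α (mul α n)

/-- The natural number `n` as the ordinal term `1 + ⋯ + 1`. -/
def ofNat (n : ℕ) : OTerm N := mul one n

/-- The order `α > β`: sums are compared lexicographically, summand by summand, and
`ψ`-terms like in a lexicographic path order. -/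
inductive Gt : OTerm N → OTerm N → Prop
  | zero {a : Fin (N + 1) → OTerm N} {r : OTerm N} : Gt (add a r) zero
  | head {a b : Fin (N + 1) → OTerm N} {r s : OTerm N} :
      Gt (psi a) (psi b) → Gt (add a r) (add b s)
  | tail {a : Fin (N + 1) → OTerm N} {r s : OTerm N} : Gt r s → Gt (add a r) (add a s)
  | psiSubEq {a b : Fin (N + 1) → OTerm N} (k : Fin (N + 1)) :
      a k = psi b → Gt (psi a) (psi b)
  | psiSubGt {a b : Fin (N + 1) → OTerm N} (k : Fin (N + 1)) :
      Gt (a k) (psi b) → Gt (psi a) (psi b)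
  | psiLex {a b : Fin (N + 1) → OTerm N} (i₀ : Fin (N + 1)) :
      (∀ l, Gt (psi a) (b l)) → (∀ l, l < i₀ → a l = b l) → Gt (a i₀) (b i₀) →
      Gt (psi a) (psi b)

/-- `α ≥ β` -/
def Ge (α β : OTerm N) : Prop := α = β ∨ Gt α β

/-- The lexicographic order on sequences of ordinal terms. -/
def LexGt {n : ℕ} (a b : Fin n → OTerm N) : Prop :=
  ∃ i, (∀ l, l < i → a l = b l) ∧ Gt (a i) (b i)

/-- Membership in `T`: in every sum `α_1 + ⋯ + α_m` occurring in the term,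
`α_1 ≥ ⋯ ≥ α_m`. -/
inductive NF : OTerm N → Prop
  | zero : NF zero
  | psi {a : Fin (N + 1) → OTerm N} : (∀ i, NF (a i)) → NF (psi a)
  | add {a b : Fin (N + 1) → OTerm N} {r : OTerm N} :
      (∀ i, NF (a i)) → Ge (OTerm.psi a) (OTerm.psi b) → NF (add b r) → NF (add a (add b r))

/-! ### Fundamental sequences -/

/-- `α` is of the form `β + 1`. -/
def IsSucc (α : OTerm N) : Prop := ∃ β, α = plus β one

/-- Removes the last summand; thus `(β + 1).init = β`. -/
def init : OTerm N → OTerm N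
  | zero => zero
  | add _ zero => zero
  | add a (add b r) => add a (init (add b r))

/-- `FixPt a α` is `α ∈ Fix(a_1, …, a_N)`. -/
def FixPt (a : Fin N → OTerm N) (α : OTerm N) : Prop :=
  ∃ c : Fin (N + 1) → OTerm N,
    α = psi c ∧ LexGt (fun i : Fin N => c i.castSucc) a ∧ ∀ i, Gt (psi c) (a i)

open Classical in
/-- The set of interesting subterms of a term, relative to `a_1, …, a_N`. -/
noncomputable def interesting (a : Fin N → OTerm N) : OTerm N → Set (OTerm N)
  | zero => ∅
  | add c r =>
      (if (fun i : Fin N => c i.castSucc) = a ∨ LexGt (fun i : Fin N => c i.castSucc) a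
        then {psi c} else ⋃ i, interesting a (c i)) ∪ interesting a r

open Classical in
/-- The greatest element of a set of ordinal terms, `0` if there is none. -/
noncomputable def maxOf (S : Set (OTerm N)) : OTerm N :=
  if h : ∃ μ ∈ S, ∀ β ∈ S, Ge μ β then h.choose else zero

/-- The maximal interesting subterm of `a_1, …, a_N`, relative to `a_1, …, a_N`. -/
noncomputable def maxInteresting (a : Fin N → OTerm N) : OTerm N :=
  maxOf (⋃ i, interesting a (a i))

/-- `a_i` is the last nonzero term among `a_1, …, a_N`. -/
def IsLastNonzero (a : Fin (N + 1) → OTerm N) (i : Fin N) : Prop :=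
  a i.castSucc ≠ zero ∧ ∀ l : Fin N, i < l → a l.castSucc = zero

/-- `ψ(a_1, …, a_i - 1, z, 0, …, 0)`, where `a_i` is a successor. -/
def psiDec (a : Fin (N + 1) → OTerm N) (i : Fin N) (z : OTerm N) : OTerm N :=
  psi (fun p => if p < i.castSucc then a p else if p = i.castSucc then init (a p)
    else if p = i.succ then z else zero)

open Classical in
/-- `ψ(a_1, …, a_(N+1))[x]`, where `a' p` is `a_p[x]`. In the case distinction, the last argument
is `0`, a successor, a limit in `Fix(a_1, …, a_N)`, or another limit. -/
noncomputable def fundPsi (x : ℕ) (a a' : Fin (N + 1) → OTerm N) : OTerm N :=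
  let β := a (Fin.last N)
  -- `ψ(a_1, …, a_N, z)`
  let last (z : OTerm N) : OTerm N := psi (Function.update a (Fin.last N) z)
  let fixed : Prop := FixPt (fun p : Fin N => a p.castSucc) β
  if h : ∃ i : Fin N, IsLastNonzero a i then
    let i := h.choose
    if IsSucc (a i.castSucc) then
      if β = zero then (psiDec a i)^[x + 1] zero
      else if IsSucc β then (psiDec a i)^[x + 1] (last (init β))
      else if fixed then (psiDec a i)^[x + 1] β
      else last (a' (Fin.last N))
    else
      -- `ψ(a_1, …, a_i[x], 0, …, 0, z)`
      let lim (z : OTerm N) : OTerm N :=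
        psi (Function.update (Function.update a i.castSucc (a' i.castSucc)) (Fin.last N) z)
      if β = zero then lim (maxInteresting (fun p : Fin N => a p.castSucc))
      else if IsSucc β then lim (last (init β))
      else if fixed then lim β
      else last (a' (Fin.last N))
  else
    if β = zero then zero
    else if IsSucc β then mul (last (init β)) (x + 1)
    else if fixed then mul β (x + 1)
    else last (a' (Fin.last N))

/-- The fundamental sequence `α[x]`. -/
noncomputable def fund (x : ℕ) : OTerm N → OTerm N
  | zero => zero
  | add a zero => fundPsi x a (fun p => fund x (a p))
  | add a (add b r) => add a (fund x (add b r))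

/-! ### The generalized system of fundamental sequences -/

open Classical in
/-- Inserts the summand `ψ(a)` into a non-increasing sum. -/
noncomputable def insert (a : Fin (N + 1) → OTerm N) : OTerm N → OTerm N
  | zero => psi a
  | add b s => if Gt (psi b) (psi a) then add b (insert a s) else add a (add b s)

/-- The natural sum `α # β`: the summands of `α` and `β` in non-increasing order. -/
noncomputable def natSum : OTerm N → OTerm N → OTerm N
  | zero, β => β
  | add a r, β => insert a (natSum r β)

/-- `GenMem x α β` is `β ∈ (α)^x`. In `sumStep` and `sumPick`, `ψ(a)` is one of at least two
summands of `α`. -/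
inductive GenMem (x : ℕ) : OTerm N → OTerm N → Prop
  | sumStep {α l r β : OTerm N} {a : Fin (N + 1) → OTerm N} :
      α = plus l (add a r) → (l ≠ zero ∨ r ≠ zero) → GenMem x (psi a) β →
      GenMem x α (natSum l (natSum β r))
  | sumPick {α l r : OTerm N} {a : Fin (N + 1) → OTerm N} :
      α = plus l (add a r) → (l ≠ zero ∨ r ≠ zero) → GenMem x α (psi a)
  | psiStep {a : Fin (N + 1) → OTerm N} (i : Fin (N + 1)) {β : OTerm N} :
      GenMem x (a i) β → GenMem x (psi a) (psi (Function.update a i β))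
  | psiArg {a : Fin (N + 1) → OTerm N} (i : Fin (N + 1)) :
      a i ≠ zero → GenMem x (psi a) (plus (a i) (ofNat x))
  | psiFund {a : Fin (N + 1) → OTerm N} : GenMem x (psi a) (fund x (psi a))

/-! ### Elementary facts, used to see that the interpretation has values in `T` -/

theorem one_le_psi (a : Fin (N + 1) → OTerm N) : Ge (psi a) one := by
  by_cases h : ∃ i, a i ≠ zero
  · right
    have hw : WellFounded ((· < ·) : Fin (N + 1) → Fin (N + 1) → Prop) := wellFounded_lt
    refine Gt.psiLex (hw.min {i | a i ≠ zero} h) (fun _ => Gt.zero) (fun l hl => ?_) ?_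
    · by_contra hne
      exact hw.not_lt_min {i | a i ≠ zero} hne hl
    · have h1 : a (hw.min {i | a i ≠ zero} h) ≠ zero := hw.min_mem {i | a i ≠ zero} h
      cases h2 : a (hw.min {i | a i ≠ zero} h) with
      | zero => exact absurd h2 h1
      | add b r => exact Gt.zero
  · left
    push Not at h
    have : a = fun _ => zero := funext h
    rw [this, one]

theorem nf_one : NF (one : OTerm N) := NF.psi (fun _ => NF.zero)

theorem NF.plus_one {α : OTerm N} (h : NF α) : NF (plus α one) := by
  induction h with
  | zero => exact nf_one
  | psi ha _ => exact NF.add ha (one_le_psi _) nf_one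
  | add ha hge _ _ ih => exact NF.add ha hge ih

theorem nf_ofNat (n : ℕ) : NF (ofNat n : OTerm N) := by
  induction n with
  | zero => exact NF.zero
  | succ n ih =>
    cases n with
    | zero => exact nf_one
    | succ n => exact NF.add (fun _ => NF.zero) (Or.inl rfl) ih

end OTerm

/-- The set `T` of ordinal terms over `0`, `+` and the `(N+1)`-ary symbol `ψ`. -/
def OrdTerm (N : ℕ) : Type := {α : OTerm N // α.NF}

/-- `α >_x β` on `T`: the transitive closure of `(α)^x ∋ β`. -/
def OrdTerm.Descends {N : ℕ} (x : ℕ) : OrdTerm N → OrdTerm N → Prop :=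
  Relation.TransGen (fun α β => OTerm.GenMem x α.1 β.1)

/-- The interpretation of ground terms:
`I(f_j(s_1, …, s_m)) = ψ(j, I(s_1), …, I(s_m) + 1, 0, …, 0)` for `m > 0`, and
`I(f_j) = ψ(j, 0, …, 0)` for a constant. -/
def RTerm.interp {K : ℕ} {ar : Fin K → ℕ} :
    RTerm ar Empty → OrdTerm (RTerm.maxArity ar)
  | .var x => x.elim
  | .app f ss =>
    ⟨OTerm.psi (Fin.cons (OTerm.ofNat (f + 1)) (fun p =>
        if h : p.1 < ar f then
          (if p.1 + 1 = ar f then OTerm.plus (interp (ss ⟨p, h⟩)).1 OTerm.one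
            else (interp (ss ⟨p, h⟩)).1)
        else OTerm.zero)),
      OTerm.NF.psi (fun i => by
        refine Fin.cases ?_ (fun p => ?_) i
        · exact OTerm.nf_ofNat _
        · rw [Fin.cons_succ]
          split_ifs with h1 h2
          · exact (interp (ss ⟨p, h1⟩)).2.plus_one
          · exact (interp (ss ⟨p, h1⟩)).2
          · exact OTerm.NF.zero)⟩

/-! Count the arguments of `ψ` from `0` to `N`, so that position `0` of `I(f(s_1, …, s_m))` holds
the symbol and position `p` the argument `s_p`. One step to `I(s)[x]` gives, up to further descent,
the iterate `g^(x+1)(b)` of a function `g = nest d s` from the start `b = base s`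
(`fund_interp_reduces`). Each target of a rule is then reached from few iterates: if `s ≻ t` and `t`
has depth at most `e ≤ d`, then `g^(2e+1)(b)` descends to `I(t)` after substitution
(`nest_iterate_reduces_of_lpo`). With `x = 2d` exactly enough iterates are available. The count does
not involve the substitution, because variables have depth `0`.

Two iterates pay for one level of depth. If `Y = g^(2e+1)(b)` dominates all arguments of `t`, then
`g(g(Y))` descends to `g(Y + 1)`, since `α_i + x` is available as a descent. Lowering one position
of `ψ` by one then lets `Y + 1` be spread over the later positions as `Y, …, Y, Y + 1`
(`tup_reduces_stageTup`, `stageTup_reduces_spread`). These values dominate the arguments of `I(t)`,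
including the last one, which carries `+ 1`.

The delicate case is arity `N ≥ 2`: position `N - 1` holds the limit `I(s_(N-1))`, whose fundamental
sequence is again governed by an iterate. It is lowered to `bound + 1`, and since `ψ` of the
unmodified arguments lies in `Fix` of the new tuple, a second fundamental step starts an iteration
from that fixed point.

The whole descent takes place among terms that are hereditarily `0` or `ψ(a) + k` (`Plain`). On them
natural sum with a number is ordinary addition, so steps survive adding `1` (`Red`). -/

namespace OTerm

variable {N : ℕ}

/-! ### Sums with natural numbers -/

theorem plus_zero (α : OTerm N) : plus α zero = α := by
  induction α with
  | zero => rfl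
  | add a r _ ih => rw [plus, ih]

theorem plus_assoc (α β γ : OTerm N) : plus (plus α β) γ = plus α (plus β γ) := by
  induction α with
  | zero => rfl
  | add a r _ ih => rw [plus, plus, plus, ih]

theorem ofNat_succ (k : ℕ) : (ofNat (k + 1) : OTerm N) = add (fun _ => zero) (ofNat k) := rfl

theorem plus_ofNat_ofNat (j k : ℕ) : plus (ofNat j : OTerm N) (ofNat k) = ofNat (j + k) := by
  induction j with
  | zero => rw [Nat.zero_add]; rfl
  | succ j ih => rw [Nat.add_right_comm, ofNat_succ, ofNat_succ, plus, ih]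

theorem plus_ofNat_succ (α : OTerm N) (k : ℕ) :
    plus α (ofNat (k + 1)) = plus (plus α (ofNat k)) one := by
  rw [plus_assoc, show (one : OTerm N) = ofNat 1 from rfl, plus_ofNat_ofNat]

theorem plus_one_plus_ofNat (α : OTerm N) (k : ℕ) :
    plus (plus α one) (ofNat k) = plus α (ofNat (k + 1)) := by
  rw [plus_assoc, show (one : OTerm N) = ofNat 1 from rfl, plus_ofNat_ofNat, Nat.add_comm]

theorem plus_one_ne_zero (α : OTerm N) : plus α one ≠ zero := by
  cases α <;> simp [plus, one, psi]

theorem isSucc_plus_one (α : OTerm N) : IsSucc (plus α one) := ⟨α, rfl⟩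

theorem init_plus_one (α : OTerm N) : init (plus α one) = α := by
  induction α with
  | zero => rfl
  | add a r _ ih =>
    cases r with
    | zero => rfl
    | add b r =>
      exact congrArg (add a) ih

theorem not_isSucc_psi {c : Fin (N + 1) → OTerm N} {i : Fin (N + 1)} (h : c i ≠ zero) :
    ¬ IsSucc (psi c) := by
  rintro ⟨β, hβ⟩
  cases β with
  | zero =>
    simp only [plus, one, psi, add.injEq, and_true] at hβ
    exact h (congrFun hβ i)
  | add b r =>
    simp only [plus, psi, add.injEq] at hβ
    exact plus_one_ne_zero r hβ.2.symm

theorem NF.plus_ofNat {α : OTerm N} (h : NF α) (k : ℕ) : NF (plus α (ofNat k)) := by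
  induction k with
  | zero => rwa [show (ofNat 0 : OTerm N) = OTerm.zero from rfl, plus_zero]
  | succ k ih => rw [plus_ofNat_succ]; exact ih.plus_one

theorem not_gt_zero {α : OTerm N} : ¬ Gt zero α := nofun

theorem eq_zero_of_one_gt {α : OTerm N} (h : Gt one α) : α = zero := by
  generalize h1 : (one : OTerm N) = o at h
  induction h with
  | zero => rfl
  | head _ ih =>
    simp only [one, psi, add.injEq] at h1
    obtain ⟨rfl, rfl⟩ := h1
    exact absurd (ih rfl) (by simp [psi])
  | tail h =>
    simp only [one, psi, add.injEq] at h1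
    obtain ⟨rfl, rfl⟩ := h1
    exact absurd h not_gt_zero
  | psiSubEq k h =>
    simp only [one, psi, add.injEq] at h1
    obtain ⟨rfl, _⟩ := h1
    simp [psi] at h
  | psiSubGt k h =>
    simp only [one, psi, add.injEq] at h1
    obtain ⟨rfl, _⟩ := h1
    exact absurd h not_gt_zero
  | psiLex i _ _ h =>
    simp only [one, psi, add.injEq] at h1
    obtain ⟨rfl, _⟩ := h1
    exact absurd h not_gt_zero

/-- No `ψ`-term lies strictly below `1`, so a new summand goes in front of all the ones. -/
theorem insert_ofNat (a : Fin (N + 1) → OTerm N) (n : ℕ) :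
    insert a (ofNat n) = add a (ofNat n) := by
  cases n with
  | zero => rfl
  | succ n =>
    rw [ofNat_succ, insert, if_neg]
    intro h
    exact absurd (eq_zero_of_one_gt h) (by simp [psi])

theorem natSum_ofNat_ofNat (j k : ℕ) : natSum (ofNat j : OTerm N) (ofNat k) = ofNat (j + k) := by
  induction j with
  | zero => rw [Nat.zero_add]; rfl
  | succ j ih => rw [Nat.add_right_comm, ofNat_succ, ofNat_succ, natSum, ih, insert_ofNat]

theorem natSum_add_ofNat_ofNat (a : Fin (N + 1) → OTerm N) (j k : ℕ) :
    natSum (add a (ofNat j)) (ofNat k) = add a (ofNat (j + k)) := by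
  rw [natSum, natSum_ofNat_ofNat, insert_ofNat]

/-! ### Plain terms and stable descent steps -/

/-- Terms that are hereditarily of the form `0` or `ψ(a) + k`. -/
inductive Plain : OTerm N → Prop
  | zero : Plain zero
  | add {a : Fin (N + 1) → OTerm N} (k : ℕ) : (∀ i, Plain (a i)) → Plain (add a (ofNat k))

theorem Plain.psi {a : Fin (N + 1) → OTerm N} (h : ∀ i, Plain (a i)) : Plain (psi a) :=
  Plain.add 0 h

theorem Plain.plus_ofNat {α : OTerm N} (h : Plain α) (k : ℕ) : Plain (plus α (ofNat k)) := by
  cases h with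
  | zero =>
    cases k with
    | zero => exact Plain.zero
    | succ k => exact Plain.add k fun _ => Plain.zero
  | add j h => rw [plus, plus_ofNat_ofNat]; exact Plain.add _ h

theorem Plain.plus_one {α : OTerm N} (h : Plain α) : Plain (plus α one) := h.plus_ofNat 1

theorem plain_ofNat (k : ℕ) : Plain (ofNat k : OTerm N) := Plain.zero.plus_ofNat k

theorem NF.psi_plus_ofNat {a : Fin (N + 1) → OTerm N} (h : ∀ i, NF (a i)) (k : ℕ) :
    NF (OTerm.add a (ofNat k)) :=
  (NF.psi h).plus_ofNat k

theorem Plain.nf {α : OTerm N} (h : Plain α) : NF α := by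
  induction h with
  | zero => exact NF.zero
  | add k _ ih => exact NF.psi_plus_ofNat ih k

theorem Plain.natSum_ofNat {α : OTerm N} (h : Plain α) (k : ℕ) :
    natSum α (ofNat k) = plus α (ofNat k) := by
  cases h with
  | zero => rfl
  | add j h => rw [natSum_add_ofNat_ofNat, plus, plus_ofNat_ofNat]

/-- A step of pointwise descent that remains one after addition of natural numbers. -/
def Red (x : ℕ) (α β : OTerm N) : Prop :=
  α.NF ∧ β.NF ∧ ∀ k, GenMem x (plus α (ofNat k)) (plus β (ofNat k))

/-- The reflexive transitive closure of `Red x`. -/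
abbrev Reduces (x : ℕ) : OTerm N → OTerm N → Prop := Relation.ReflTransGen (Red x)

theorem Red.genMem {x : ℕ} {α β : OTerm N} (h : Red x α β) : GenMem x α β := by
  have := h.2.2 0
  rwa [show (ofNat 0 : OTerm N) = OTerm.zero from rfl, plus_zero, plus_zero] at this

theorem Red.plus_one {x : ℕ} {α β : OTerm N} (h : Red x α β) :
    Red x (plus α one) (plus β one) := by
  refine ⟨h.1.plus_one, h.2.1.plus_one, fun k => ?_⟩
  rw [plus_one_plus_ofNat, plus_one_plus_ofNat]
  exact h.2.2 _

theorem Reduces.plus_one {x : ℕ} {α β : OTerm N} (h : Reduces x α β) :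
    Reduces x (plus α one) (plus β one) :=
  Relation.ReflTransGen.lift (plus · one) (fun _ _ => Red.plus_one) _ _ h

theorem Reduces.nf {x : ℕ} {α β : OTerm N} (h : Reduces x α β) (hα : NF α) : NF β := by
  induction h with
  | refl => exact hα
  | tail _ h _ => exact h.2.1

/-- In `ψ(a) + k` with `k > 0` the step is taken inside a proper sum and yields the natural sum of
`β` and `k`; plainness of `β` turns this into `β + k`. -/
theorem red_psi {x : ℕ} {a : Fin (N + 1) → OTerm N} {β : OTerm N} (ha : ∀ i, NF (a i))
    (hβ : Plain β) (h : GenMem x (psi a) β) : Red x (psi a) β := by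
  refine ⟨NF.psi ha, hβ.nf, fun k => ?_⟩
  cases k with
  | zero => rwa [show (ofNat 0 : OTerm N) = zero from rfl, plus_zero, plus_zero]
  | succ k =>
    rw [← hβ.natSum_ofNat]
    exact GenMem.sumStep (l := zero) (r := ofNat (k + 1)) rfl (Or.inr (by simp [ofNat_succ])) h

theorem Red.psi_update {x : ℕ} (a : Fin (N + 1) → OTerm N) (ha : ∀ i, NF (a i))
    (i : Fin (N + 1)) {β : OTerm N} (h : Red x (a i) β) :
    Red x (psi a) (psi (Function.update a i β)) := by
  refine ⟨NF.psi ha, NF.psi fun l => ?_, fun k => ?_⟩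
  · by_cases hl : l = i
    · subst hl; rw [Function.update_self]; exact h.2.1
    · rw [Function.update_of_ne hl]; exact ha l
  · cases k with
    | zero =>
      rw [show (ofNat 0 : OTerm N) = OTerm.zero from rfl, plus_zero, plus_zero]
      exact GenMem.psiStep i h.genMem
    | succ k =>
      have := GenMem.sumStep (x := x) (l := OTerm.zero) (r := ofNat (k + 1))
        (a := a) rfl (Or.inr (by simp [ofNat_succ])) (GenMem.psiStep i h.genMem)
      rwa [show natSum (psi (Function.update a i β)) (ofNat (k + 1)) =
        plus (psi (Function.update a i β)) (ofNat (k + 1)) from insert_ofNat _ _] at this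

theorem fund_one (x : ℕ) : fund x (one : OTerm N) = zero := by
  simp [one, psi, fund, fundPsi, IsLastNonzero]

/-- The last summand `1` is replaced by `1[x] = 0`. The term `1` alone is not a proper sum, so there
the fundamental sequence is applied directly. -/
theorem Plain.red_plus_one {x : ℕ} {α : OTerm N} (h : Plain α) : Red x (plus α one) α := by
  refine ⟨h.plus_one.nf, h.nf, fun k => ?_⟩
  have key : ∀ β : OTerm N, Plain β → β ≠ OTerm.zero → GenMem x (plus β one) β := by
    intro β hβ hne
    have := GenMem.sumStep (x := x) (α := plus β one) (l := β) (r := OTerm.zero)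
      (a := fun _ => OTerm.zero) rfl (Or.inl hne) GenMem.psiFund
    have h1 : fund x (OTerm.psi fun _ => OTerm.zero : OTerm N) = OTerm.zero := fund_one x
    rw [h1] at this
    rwa [show natSum OTerm.zero (OTerm.zero : OTerm N) = ofNat 0 from rfl, hβ.natSum_ofNat,
      show (ofNat 0 : OTerm N) = OTerm.zero from rfl, plus_zero] at this
  by_cases hz : plus α (ofNat k) = OTerm.zero
  · rw [plus_one_plus_ofNat, plus_ofNat_succ, hz]
    have := GenMem.psiFund (x := x) (a := fun _ : Fin (N + 1) => OTerm.zero)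
    rwa [show fund x (OTerm.psi fun _ => OTerm.zero : OTerm N) = OTerm.zero from fund_one x] at this
  · rw [plus_one_plus_ofNat, plus_ofNat_succ]
    exact key _ (h.plus_ofNat k) hz

theorem Plain.plus_ofNat_reduces {x : ℕ} {α : OTerm N} (h : Plain α) {j k : ℕ} (hjk : j ≤ k) :
    Reduces x (plus α (ofNat k)) (plus α (ofNat j)) := by
  induction hjk with
  | refl => exact .refl
  | step _ ih =>
    refine Relation.ReflTransGen.head ?_ ih
    rw [Nat.succ_eq_add_one, plus_ofNat_succ]
    exact (h.plus_ofNat _).red_plus_one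

theorem Plain.plus_ofNat_reduces_self {x : ℕ} {α : OTerm N} (h : Plain α) (k : ℕ) :
    Reduces x (plus α (ofNat k)) α := by
  have := h.plus_ofNat_reduces (x := x) (Nat.zero_le k)
  rwa [show (ofNat 0 : OTerm N) = OTerm.zero from rfl, plus_zero] at this

theorem ofNat_reduces {x j k : ℕ} (hjk : j ≤ k) : Reduces x (ofNat k : OTerm N) (ofNat j) :=
  Plain.zero.plus_ofNat_reduces hjk

theorem psi_mono {x : ℕ} {a b : Fin (N + 1) → OTerm N} (ha : ∀ i, NF (a i))
    (h : ∀ i, Reduces x (a i) (b i)) : Reduces x (psi a) (psi b) := by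
  have hb : ∀ i, NF (b i) := fun i => (h i).nf (ha i)
  have single : ∀ (c : Fin (N + 1) → OTerm N), (∀ i, NF (c i)) → ∀ i β, Reduces x (c i) β →
      Reduces x (psi c) (psi (Function.update c i β)) := by
    intro c hc i β hβ
    induction hβ with
    | refl => rw [Function.update_eq_self]
    | tail h1 h2 ih =>
      refine ih.tail ?_
      have := Red.psi_update (x := x) (Function.update c i _) (fun l => ?_) i
        (by rw [Function.update_self]; exact h2)
      · rwa [Function.update_idem] at this
      · by_cases hl : l = i
        · subst hl; rw [Function.update_self]; exact h2.1
        · rw [Function.update_of_ne hl]; exact hc l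
  -- The arguments are exchanged one position at a time.
  have all : ∀ s : Finset (Fin (N + 1)),
      Reduces x (psi a) (psi fun i => if i ∈ s then b i else a i) := by
    intro s
    induction s using Finset.induction_on with
    | empty => simpa using Relation.ReflTransGen.refl
    | insert i s hi ih =>
      refine ih.trans ?_
      convert single _ (fun l => ?_) i (b i) ?_ using 2
      · funext l
        by_cases hl : l = i
        · subst hl; simp
        · simp [hl]
      · split_ifs
        · exact hb l
        · exact ha l
      · rw [if_neg hi]; exact h i
  simpa using all Finset.univ

theorem one_reduces_zero {x : ℕ} : Reduces x (one : OTerm N) zero :=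
  .single Plain.zero.red_plus_one

theorem Plain.reduces_zero {x : ℕ} {α : OTerm N} (h : Plain α) : Reduces x α OTerm.zero := by
  induction h with
  | zero => exact .refl
  | @add a k ha ih =>
    exact ((Plain.psi ha).plus_ofNat_reduces_self k).trans
      ((psi_mono (fun i => (ha i).nf) ih).trans one_reduces_zero)

theorem red_psi_arg {x : ℕ} {a : Fin (N + 1) → OTerm N} (ha : ∀ i, Plain (a i))
    {i : Fin (N + 1)} (hi : a i ≠ zero) : Red x (psi a) (plus (a i) (ofNat x)) :=
  red_psi (fun l => (ha l).nf) ((ha i).plus_ofNat x) (GenMem.psiArg i hi)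

theorem psi_reduces_arg {x : ℕ} {a : Fin (N + 1) → OTerm N} (ha : ∀ i, Plain (a i))
    (i : Fin (N + 1)) : Reduces x (psi a) (a i) := by
  by_cases hi : a i = zero
  · rw [hi]; exact (Plain.psi ha).reduces_zero
  · exact .head (red_psi_arg ha hi) ((ha i).plus_ofNat_reduces_self x)

/-- The descent to `α_i + x` leaves a successor once `x ≥ 1`. Every `+ 1` gained in the later
descents has this origin, which is why nonzero arguments are required there. -/
theorem psi_reduces_arg_plus_one {x : ℕ} (hx : 1 ≤ x) {a : Fin (N + 1) → OTerm N}
    (ha : ∀ i, Plain (a i)) {i : Fin (N + 1)} (hi : a i ≠ zero) :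
    Reduces x (psi a) (plus (a i) one) :=
  .head (red_psi_arg ha hi) ((ha i).plus_ofNat_reduces hx)

/-! ### Tuples as sequences, and their fundamental sequences -/

/-- `ψ(c 0, …, c N)` for an infinite sequence `c`. -/
def tup (c : ℕ → OTerm N) : OTerm N := psi fun p => c p.1

/-- The sequence `c 0, …, c (i - 1), v, z, 0, 0, …`. -/
def stage (c : ℕ → OTerm N) (i : ℕ) (v z : OTerm N) : ℕ → OTerm N := fun p =>
  if p < i then c p else if p = i then v else if p = i + 1 then z else zero

theorem tup_congr {c d : ℕ → OTerm N} (h : ∀ p ≤ N, c p = d p) : tup c = tup d :=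
  congrArg psi (funext fun p => h p.1 (Nat.lt_succ_iff.mp p.2))

theorem tup_ne_zero (c : ℕ → OTerm N) : tup c ≠ zero := by simp [tup, psi]

theorem plain_tup {c : ℕ → OTerm N} (h : ∀ p, Plain (c p)) : Plain (tup c) :=
  Plain.psi fun _ => h _

theorem plain_stage {c : ℕ → OTerm N} {i : ℕ} {v z : OTerm N} (h : ∀ p < i, Plain (c p))
    (hv : Plain v) (hz : Plain z) (p : ℕ) : Plain (stage c i v z p) := by
  unfold stage
  split_ifs with h1
  exacts [h p h1, hv, hz, Plain.zero]

theorem tup_mono {x : ℕ} {c d : ℕ → OTerm N} (hc : ∀ p, Plain (c p))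
    (h : ∀ p ≤ N, Reduces x (c p) (d p)) : Reduces x (tup c) (tup d) :=
  psi_mono (fun _ => (hc _).nf) fun p => h p.1 (Nat.lt_succ_iff.mp p.2)

theorem tup_reduces_arg {x : ℕ} {c : ℕ → OTerm N} (hc : ∀ p, Plain (c p)) {p : ℕ} (hp : p ≤ N) :
    Reduces x (tup c) (c p) :=
  psi_reduces_arg (a := fun p => c p.1) (fun _ => hc _) ⟨p, Nat.lt_succ_iff.mpr hp⟩

theorem tup_reduces_arg_plus_one {x : ℕ} (hx : 1 ≤ x) {c : ℕ → OTerm N} (hc : ∀ p, Plain (c p))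
    {p : ℕ} (hp : p ≤ N) (h : c p ≠ zero) : Reduces x (tup c) (plus (c p) one) :=
  psi_reduces_arg_plus_one hx (a := fun p => c p.1) (fun _ => hc _)
    (i := ⟨p, Nat.lt_succ_iff.mpr hp⟩) h

theorem stage_self (c : ℕ → OTerm N) (i : ℕ) (v z : OTerm N) : stage c i v z i = v := by
  simp [stage]

theorem stage_succ (c : ℕ → OTerm N) (i : ℕ) (v z : OTerm N) : stage c i v z (i + 1) = z := by
  simp [stage]

theorem stage_mono {x : ℕ} (c : ℕ → OTerm N) (i : ℕ) {v v' z z' : OTerm N}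
    (hv : Reduces x v v') (hz : Reduces x z z') (p : ℕ) :
    Reduces x (stage c i v z p) (stage c i v' z' p) := by
  unfold stage
  split_ifs
  exacts [.refl, hv, hz, .refl]

theorem IsLastNonzero.unique {a : Fin (N + 1) → OTerm N} {i j : Fin N} (hi : IsLastNonzero a i)
    (hj : IsLastNonzero a j) : i = j := by
  rcases lt_trichotomy i j with h | h | h
  · exact absurd (hi.2 j h) hj.1
  · exact h
  · exact absurd (hj.2 i h) hi.1

theorem fund_tup (x : ℕ) (c : ℕ → OTerm N) :
    fund x (tup c) = fundPsi x (fun p => c p.1) (fun p => fund x (c p.1)) := rfl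

theorem psiDec_tup {c : ℕ → OTerm N} {i : Fin N} {v : OTerm N} (hv : c i = plus v one) :
    psiDec (fun p => c p.1) i = fun z => tup (stage c i v z) := by
  funext z
  refine congrArg psi (funext fun p => ?_)
  simp only [stage, Fin.lt_def, Fin.ext_iff, Fin.val_castSucc, Fin.val_succ]
  split_ifs with h1 h2
  · rfl
  · rw [h2, hv, init_plus_one]
  · rfl
  · rfl

theorem update_tup (c : ℕ → OTerm N) (z : OTerm N) :
    psi (Function.update (fun p : Fin (N + 1) => c p.1) (Fin.last N) z) =
      tup (Function.update c N z) := by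
  refine congrArg psi (funext fun p => ?_)
  simp only [Function.update_apply, Fin.ext_iff, Fin.val_last]

theorem isLastNonzero_tup {c : ℕ → OTerm N} {i : ℕ} (hi : i < N) (h : c i ≠ zero)
    (h0 : ∀ l, i < l → l < N → c l = zero) :
    IsLastNonzero (fun p : Fin (N + 1) => c p.1) ⟨i, hi⟩ :=
  ⟨h, fun l hl => h0 l.1 hl l.2⟩

section
variable {x i : ℕ} {c : ℕ → OTerm N} (hi : i < N) (h0 : ∀ l, i < l → l < N → c l = zero)
include hi h0

/-- This and the next three lemmas cover the cases of `ψ[x]` that occur below. The index picked by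
`Exists.choose` is `i` because the last nonzero position is unique. -/
theorem fund_tup_succ_zero {v : OTerm N} (hv : c i = plus v one) (hN : c N = zero) :
    fund x (tup c) = (fun z => tup (stage c i v z))^[x + 1] zero := by
  have hl := isLastNonzero_tup hi (by rw [hv]; exact plus_one_ne_zero v) h0
  have hex : ∃ i, IsLastNonzero (fun p : Fin (N + 1) => c p.1) i := ⟨_, hl⟩
  have hs' : IsSucc (c hex.choose) := by
    rw [hex.choose_spec.unique hl, hv]; exact isSucc_plus_one v
  rw [fund_tup, fundPsi]
  simp only [dif_pos hex, hex.choose_spec.unique hl, Fin.val_castSucc, Fin.val_last, if_pos hs',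
    if_pos hN]
  rw [psiDec_tup (i := ⟨i, hi⟩) hv]

theorem fund_tup_succ_succ {v β : OTerm N} (hv : c i = plus v one) (hN : c N = plus β one) :
    fund x (tup c) =
      (fun z => tup (stage c i v z))^[x + 1] (tup (Function.update c N β)) := by
  have hl := isLastNonzero_tup hi (by rw [hv]; exact plus_one_ne_zero v) h0
  have hex : ∃ i, IsLastNonzero (fun p : Fin (N + 1) => c p.1) i := ⟨_, hl⟩
  have hs' : IsSucc (c hex.choose) := by
    rw [hex.choose_spec.unique hl, hv]; exact isSucc_plus_one v
  have hz : c N ≠ zero := by rw [hN]; exact plus_one_ne_zero β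
  have hN' : IsSucc (c N) := by rw [hN]; exact isSucc_plus_one β
  rw [fund_tup, fundPsi]
  simp only [dif_pos hex, hex.choose_spec.unique hl, Fin.val_castSucc, Fin.val_last, if_pos hs',
    if_neg hz, if_pos hN', update_tup]
  rw [psiDec_tup (i := ⟨i, hi⟩) hv, hN, init_plus_one]

theorem fund_tup_succ_fixPt {v : OTerm N} (hv : c i = plus v one) (hz : c N ≠ zero)
    (hN : ¬ IsSucc (c N)) (hf : FixPt (fun p : Fin N => c p.1) (c N)) :
    fund x (tup c) = (fun z => tup (stage c i v z))^[x + 1] (c N) := by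
  have hl := isLastNonzero_tup hi (by rw [hv]; exact plus_one_ne_zero v) h0
  have hex : ∃ i, IsLastNonzero (fun p : Fin (N + 1) => c p.1) i := ⟨_, hl⟩
  have hs' : IsSucc (c hex.choose) := by
    rw [hex.choose_spec.unique hl, hv]; exact isSucc_plus_one v
  rw [fund_tup, fundPsi]
  simp only [dif_pos hex, hex.choose_spec.unique hl, Fin.val_castSucc, Fin.val_last, if_pos hs',
    if_neg hz, if_neg hN, if_pos hf]
  rw [psiDec_tup (i := ⟨i, hi⟩) hv]

theorem fund_tup_limit_succ {β : OTerm N} (hv : c i ≠ zero) (hs : ¬ IsSucc (c i))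
    (hN : c N = plus β one) :
    fund x (tup c) = tup (Function.update (Function.update c i (fund x (c i))) N
      (tup (Function.update c N β))) := by
  have hl := isLastNonzero_tup hi hv h0
  have hex : ∃ i, IsLastNonzero (fun p : Fin (N + 1) => c p.1) i := ⟨_, hl⟩
  have hs' : ¬ IsSucc (c hex.choose) := by rwa [hex.choose_spec.unique hl]
  have hz : c N ≠ zero := by rw [hN]; exact plus_one_ne_zero β
  have hN' : IsSucc (c N) := by rw [hN]; exact isSucc_plus_one β
  rw [fund_tup, fundPsi]
  simp only [dif_pos hex, hex.choose_spec.unique hl, Fin.val_castSucc, Fin.val_last, if_neg hs',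
    if_neg hz, if_pos hN', update_tup]
  rw [hN, init_plus_one, ← update_tup]
  congr 2
  funext p
  simp only [Function.update_apply, Fin.ext_iff, Fin.val_castSucc, Fin.val_last]

end

theorem red_fund_tup {x : ℕ} {c : ℕ → OTerm N} (hc : ∀ p, Plain (c p))
    (h : Plain (fund x (tup c))) : Red x (tup c) (fund x (tup c)) :=
  red_psi (fun _ => (hc _).nf) h GenMem.psiFund

/-! ### Iterates, and moving values to other positions -/

theorem plain_iterate {g : OTerm N → OTerm N} (hg : ∀ z, Plain z → Plain (g z)) {b : OTerm N}
    (hb : Plain b) (n : ℕ) : Plain (g^[n] b) := by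
  induction n with
  | zero => exact hb
  | succ n ih => rw [Function.iterate_succ_apply']; exact hg _ ih

theorem iterate_reduces {x : ℕ} {g : OTerm N → OTerm N} (hg : ∀ z, Plain z → Plain (g z))
    (hr : ∀ z, Plain z → Reduces x (g z) z) {b : OTerm N} (hb : Plain b) {m n : ℕ}
    (hmn : m ≤ n) : Reduces x (g^[n] b) (g^[m] b) := by
  induction hmn with
  | refl => exact .refl
  | @step k _ ih =>
    rw [Nat.succ_eq_add_one, Function.iterate_succ_apply']
    exact (hr _ (plain_iterate hg hb k)).trans ih

/-- The function `z ↦ ψ(c 0, …, c (i - 1), v, z, 0, …, 0)`. -/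
abbrev stageTup (c : ℕ → OTerm N) (i : ℕ) (v : OTerm N) : OTerm N → OTerm N :=
  fun z => tup (stage c i v z)

theorem plain_stageTup {c : ℕ → OTerm N} {i : ℕ} {v z : OTerm N} (h : ∀ p < i, Plain (c p))
    (hv : Plain v) (hz : Plain z) : Plain (stageTup c i v z) :=
  plain_tup (plain_stage h hv hz)

section
variable {x i : ℕ} {c : ℕ → OTerm N} {v : OTerm N} (hi : i < N) (h : ∀ p < i, Plain (c p))
  (hv : Plain v)
include hi h hv

theorem stageTup_reduces {z : OTerm N} (hz : Plain z) : Reduces x (stageTup c i v z) z := by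
  have := tup_reduces_arg (x := x) (plain_stage h hv hz) (p := i + 1) hi
  rwa [stage_succ] at this

omit hi in
theorem stageTup_mono {z z' : OTerm N} (hz : Plain z) (hr : Reduces x z z') :
    Reduces x (stageTup c i v z) (stageTup c i v z') :=
  tup_mono (plain_stage h hv hz) fun p _ => stage_mono c i .refl hr p

/-- Two nested applications of `stageTup` retain a successor. -/
theorem stageTup_stageTup_reduces (hx : 1 ≤ x) {z : OTerm N} (hz : Plain z) (hne : z ≠ zero) :
    Reduces x (stageTup c i v (stageTup c i v z)) (stageTup c i v (plus z one)) := by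
  refine stageTup_mono h hv (plain_stageTup h hv hz) ?_
  have := tup_reduces_arg_plus_one hx (plain_stage h hv hz) (p := i + 1) hi
    (by rwa [stage_succ])
  rwa [stage_succ] at this

omit hi in
theorem plain_stageTup_iterate {b : OTerm N} (hb : Plain b) (n : ℕ) :
    Plain ((stageTup c i v)^[n] b) :=
  plain_iterate (fun _ => plain_stageTup h hv) hb n

theorem stageTup_iterate_reduces {b : OTerm N} (hb : Plain b) {m n : ℕ} (hmn : m ≤ n) :
    Reduces x ((stageTup c i v)^[n] b) ((stageTup c i v)^[m] b) :=
  iterate_reduces (fun _ => plain_stageTup h hv) (fun _ => stageTup_reduces hi h hv) hb hmn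

end

theorem plain_update {c : ℕ → OTerm N} (hc : ∀ p, Plain (c p)) (i : ℕ) {v : OTerm N}
    (hv : Plain v) (p : ℕ) : Plain (Function.update c i v p) := by
  rw [Function.update_apply]; split_ifs
  exacts [hv, hc p]

/-- The fundamental sequence is `g^(x+1)(0)` with `Z` at position `n` of `g`. Since `x ≥ 1`, at
least two applications are present, and the inner one has `Z` as an argument, hence descends to `Z +
1`. -/
theorem tup_reduces_stageTup_of_lt {x n : ℕ} (hx : 1 ≤ x) (hn : n < N) {c : ℕ → OTerm N}
    {Z : OTerm N} (hc : ∀ p, Plain (c p)) (hZ : Plain Z) (hne : Z ≠ zero)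
    (hcn : c n = plus Z one) (h0 : ∀ l, n < l → c l = zero) :
    Reduces x (tup c) (stageTup c n Z (plus Z one)) := by
  have hp := plain_stageTup_iterate (i := n) (fun p _ => hc p) hZ Plain.zero (x + 1)
  have hf := fund_tup_succ_zero (x := x) hn (fun l h _ => h0 l h) hcn (h0 N hn)
  refine .head (red_fund_tup hc (hf ▸ hp)) ?_
  rw [hf]
  obtain ⟨y, rfl⟩ := Nat.exists_eq_add_of_le' hx
  rw [Function.iterate_succ_apply']
  have hp' := plain_stageTup_iterate (i := n) (fun p _ => hc p) hZ Plain.zero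
  refine stageTup_mono (fun p _ => hc p) hZ (hp' _) ?_
  rw [Function.iterate_succ_apply']
  have := tup_reduces_arg_plus_one hx (plain_stage (fun p _ => hc p) hZ (hp' y)) hn.le
    (by rwa [stage_self])
  rwa [stage_self] at this

/-- To lower position `i`, the nonzero entry at `q` must first be out of the way. It is pushed
right, one position at a time, until it is the last argument of `ψ`; only then does the fundamental
sequence act on position `i`. Hence the induction on `q` downwards from `N`. -/
theorem tup_reduces_stageTup {x i q : ℕ} (hx : 1 ≤ x) (hiq : i < q) (hq : q ≤ N)
    {v Z : OTerm N} (hv : Plain v) (hZ : Plain Z) (hne : Z ≠ zero) (c : ℕ → OTerm N)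
    (hc : ∀ p, Plain (c p))
    (hci : c i = plus v one) (hcq : c q = plus Z one) (h0 : ∀ l, i < l → l ≠ q → c l = zero) :
    Reduces x (tup c) (stageTup c i v (plus Z one)) := by
  induction hq using Nat.decreasingInduction generalizing c with
  | self =>
    have hb : Plain (tup (Function.update c N Z)) := plain_tup (plain_update hc N hZ)
    have hp := fun n => plain_stageTup_iterate (i := i) (fun p _ => hc p) hv hb n
    have hf := fund_tup_succ_succ (x := x) hiq (fun l h h' => h0 l h h'.ne) hci hcq
    refine .head (red_fund_tup hc (hf ▸ hp _)) ?_
    rw [hf]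
    -- One application suffices: its start is a `ψ`-term with last argument `Z`, which descends to
    -- `Z + 1`.
    refine (stageTup_iterate_reduces hiq (fun p _ => hc p) hv hb
      (Nat.succ_le_succ (Nat.zero_le x))).trans ?_
    refine stageTup_mono (fun p _ => hc p) hv hb ?_
    have := tup_reduces_arg_plus_one hx (plain_update hc N hZ) le_rfl
      (by rwa [Function.update_self])
    rwa [Function.update_self] at this
  | of_succ q hq ih =>
    refine (tup_reduces_stageTup_of_lt hx hq hc hZ hne hcq
      fun l hl => h0 l (hiq.trans hl) hl.ne').trans ?_
    -- The copy of `Z` left at position `q` is discarded, so that only positions up to `i` and `q +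
    -- 1` can be nonzero.
    set d := Function.update (Function.update c q zero) (q + 1) (plus Z one) with hd
    have hdp : ∀ p, Plain (d p) := plain_update (plain_update hc _ Plain.zero) _ hZ.plus_one
    have h1 : Reduces x (stageTup c q Z (plus Z one)) (tup d) := by
      refine tup_mono (plain_stage (fun p _ => hc p) hZ hZ.plus_one) fun p _ => ?_
      simp only [hd, stage, Function.update_apply]
      split_ifs with h1 h2 h3 h4 h5 h6
      any_goals omega
      · exact .refl
      · exact hZ.reduces_zero
      · exact .refl
      · rw [h0 p (by omega) (by omega)]
    refine h1.trans ?_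
    have h2 := ih (by omega) d hdp (by simp [hd, Function.update_apply, hci]; grind)
      (by simp [hd]) (fun l hl hlq => by
        simp only [hd, Function.update_apply, if_neg hlq]
        split_ifs with h
        · rfl
        · exact h0 l hl h)
    convert h2 using 1
    refine tup_congr fun p _ => ?_
    simp only [hd, stage, Function.update_apply]
    grind

/-- `ψ(c 0, …, c (i - 1), v, Z + 1, 0, …, 0)` reduces to
`ψ(c 0, …, c (i - 1), v, Z, …, Z, Z + 1, 0, …, 0)`. -/
theorem stageTup_reduces_spread {x i n : ℕ} (hx : 1 ≤ x) (hin : i < n) (hn : n ≤ N)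
    {v Z : OTerm N} (hv : Plain v) (hZ : Plain Z) (hne : Z ≠ zero) {c : ℕ → OTerm N}
    (hc : ∀ p, Plain (c p)) :
    Reduces x (stageTup c i v (plus Z one)) (tup fun p =>
      if p < i then c p else if p = i then v else if p < n then Z
        else if p = n then plus Z one else zero) := by
  induction n, hin using Nat.le_induction with
  | base =>
    rw [tup_congr]
    intro p _
    simp only [stage]
    grind
  | succ n hin ih =>
    refine (ih (by omega)).trans ?_
    refine (tup_reduces_stageTup_of_lt (n := n) hx (by omega) (fun p => ?_) hZ hne
      ?_ fun l hl => ?_).trans ?_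
    · split_ifs
      exacts [hc p, hv, hZ, hZ.plus_one, Plain.zero]
    · grind
    · grind
    · rw [stageTup, tup_congr]
      intro p _
      simp only [stage]
      grind

/-! ### Comparisons in the order `>` -/

theorem gt_plus_one (α : OTerm N) : Gt (plus α one) α := by
  induction α with
  | zero => exact Gt.zero
  | add a r _ ih => exact Gt.tail ih

theorem plus_ofNat_one (k : ℕ) : plus (ofNat k : OTerm N) one = ofNat (k + 1) :=
  plus_ofNat_ofNat k 1

theorem gt_tup_ofNat {c : ℕ → OTerm N} (h : Gt (c 0) zero) (k : ℕ) : Gt (tup c) (ofNat k) := by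
  cases k with
  | zero => exact Gt.zero
  | succ k =>
    exact Gt.head (Gt.psiLex 0 (fun _ => Gt.zero) (fun l hl => absurd hl (Fin.not_lt_zero l)) h)

theorem gt_tup_of_gt {c : ℕ → OTerm N} {p : ℕ} (hp : p ≤ N) {b : Fin (N + 1) → OTerm N}
    (h : Gt (c p) (psi b)) : Gt (tup c) (psi b) :=
  Gt.psiSubGt (a := fun p => c p.1) ⟨p, Nat.lt_succ_iff.mpr hp⟩ h

theorem gt_tup_of_eq {c : ℕ → OTerm N} {p : ℕ} (hp : p ≤ N) {b : Fin (N + 1) → OTerm N}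
    (h : c p = psi b) : Gt (tup c) (psi b) :=
  Gt.psiSubEq (a := fun p => c p.1) ⟨p, Nat.lt_succ_iff.mpr hp⟩ h

theorem gt_tup_tup {c d : ℕ → OTerm N} {i : ℕ} (hi : i ≤ N) (h : ∀ p ≤ N, Gt (tup c) (d p))
    (heq : ∀ p < i, c p = d p) (hgt : Gt (c i) (d i)) : Gt (tup c) (tup d) :=
  Gt.psiLex (a := fun p => c p.1) (b := fun p => d p.1) ⟨i, Nat.lt_succ_iff.mpr hi⟩
    (fun l => h l.1 (Nat.lt_succ_iff.mp l.2)) (fun l hl => heq l.1 hl) hgt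

end OTerm

namespace RTerm

open OTerm

variable {K : ℕ} {ar : Fin K → ℕ} {V : Type*}

/-! ### The interpretation as a tuple -/

theorem ar_le_maxArity (f : Fin K) : ar f ≤ maxArity ar :=
  Finset.le_sup (f := ar) (Finset.mem_univ f)

/-- The sequence `j, I(s_1), …, I(s_m), 0, 0, …`. -/
def args (f : Fin K) (ss : Fin (ar f) → RTerm ar Empty) : ℕ → OTerm (maxArity ar)
  | 0 => ofNat (f + 1)
  | p + 1 => if h : p < ar f then (interp (ss ⟨p, h⟩)).1 else zero

/-- The arguments of `ψ` in `I(f_j(s_1, …, s_m))`. -/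
def interpArgs (f : Fin K) (ss : Fin (ar f) → RTerm ar Empty) (p : ℕ) : OTerm (maxArity ar) :=
  if p = ar f ∧ 0 < p then plus (args f ss p) one else args f ss p

theorem interp_app (f : Fin K) (ss : Fin (ar f) → RTerm ar Empty) :
    (interp (app f ss)).1 = tup (interpArgs f ss) := by
  rw [interp]
  refine congrArg psi (funext fun p => ?_)
  refine Fin.cases ?_ (fun p => ?_) p
  · rw [Fin.cons_zero, Fin.val_zero, interpArgs, if_neg (by simp), args]
  · rw [Fin.cons_succ, Fin.val_succ, interpArgs, args]
    by_cases h1 : p.1 < ar f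
    · simp [h1]
    · rw [dif_neg h1, dif_neg h1, if_neg (by omega)]

section
variable (f : Fin K) (ss : Fin (ar f) → RTerm ar Empty)

theorem args_zero : args f ss 0 = ofNat (f + 1) := rfl

theorem args_succ (k : Fin (ar f)) : args f ss (k + 1) = (interp (ss k)).1 := by
  rw [args, dif_pos k.2]

theorem args_of_lt {p : ℕ} (h : ar f < p) : args f ss p = zero := by
  cases p with
  | zero => omega
  | succ p => rw [args, dif_neg (by omega)]

theorem interpArgs_of_ne {p : ℕ} (h : p ≠ ar f) : interpArgs f ss p = args f ss p :=
  if_neg fun h' => h h'.1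

theorem interpArgs_zero : interpArgs f ss 0 = ofNat (f + 1) := if_neg (by simp)

theorem interpArgs_of_eq {p : ℕ} (h : p = ar f) (hp : 0 < p) :
    interpArgs f ss p = plus (args f ss p) one := if_pos ⟨h, hp⟩

theorem interpArgs_ar (h : 0 < ar f) :
    interpArgs f ss (ar f) = plus (args f ss (ar f)) one := interpArgs_of_eq f ss rfl h

theorem exists_interp_eq_psi (s : RTerm ar Empty) : ∃ b, (interp s).1 = psi b := by
  cases s with
  | var y => exact y.elim
  | app f ss => exact ⟨_, interp_app f ss⟩

theorem interp_ne_zero (s : RTerm ar Empty) : (interp s).1 ≠ zero := by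
  obtain ⟨b, hb⟩ := exists_interp_eq_psi s
  rw [hb]; simp [psi]

theorem args_cases (p : ℕ) : p = 0 ∨ (∃ k : Fin (ar f), p = k + 1) ∨ ar f < p := by
  rcases p with _ | p
  · exact .inl rfl
  · rcases Nat.lt_or_ge p (ar f) with h | h
    · exact .inr (.inl ⟨⟨p, h⟩, rfl⟩)
    · exact .inr (.inr (by omega))

theorem plain_args_of (h : ∀ k, Plain (interp (ss k)).1) (p : ℕ) : Plain (args f ss p) := by
  rcases args_cases (ar := ar) f p with rfl | ⟨k, rfl⟩ | h'
  · exact plain_ofNat _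
  · rw [args_succ]; exact h k
  · rw [args_of_lt f ss h']; exact Plain.zero

theorem plain_interpArgs_of (h : ∀ k, Plain (interp (ss k)).1) (p : ℕ) :
    Plain (interpArgs f ss p) := by
  unfold interpArgs
  split_ifs
  exacts [(plain_args_of f ss h p).plus_one, plain_args_of f ss h p]

theorem plain_interp (s : RTerm ar Empty) : Plain (interp s).1 := by
  induction s with
  | var y => exact y.elim
  | app f ss ih => rw [interp_app]; exact plain_tup (plain_interpArgs_of f ss ih)

theorem plain_args : ∀ p, Plain (args f ss p) := plain_args_of f ss fun k => plain_interp (ss k)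

theorem plain_interpArgs : ∀ p, Plain (interpArgs f ss p) :=
  plain_interpArgs_of f ss fun k => plain_interp (ss k)

theorem interpArgs_reduces_args {x : ℕ} (p : ℕ) :
    Reduces x (interpArgs f ss p) (args f ss p) := by
  unfold interpArgs
  split_ifs
  exacts [.single (plain_args f ss p).red_plus_one, .refl]

theorem gt_tup_args {c : ℕ → OTerm (maxArity ar)} (h0 : Gt (c 0) zero)
    (hc : ∀ p, c p = args f ss p ∨ c p = plus (args f ss p) one) (p : ℕ) :
    Gt (tup c) (args f ss p) := by
  rcases args_cases (ar := ar) f p with rfl | ⟨k, rfl⟩ | h'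
  · exact gt_tup_ofNat h0 _
  · have hp : k.1 + 1 ≤ maxArity ar := k.2.trans_le (ar_le_maxArity f)
    obtain ⟨b, hb⟩ := exists_interp_eq_psi (ss k)
    rw [← args_succ] at hb
    rw [hb]
    rcases hc (k + 1) with h | h
    · exact gt_tup_of_eq hp (h.trans hb)
    · refine gt_tup_of_gt hp ?_
      rw [h, ← hb]
      exact gt_plus_one _
  · rw [args_of_lt f ss h']; exact Gt.zero

theorem gt_interp_args (p : ℕ) : Gt (interp (app f ss)).1 (args f ss p) := by
  rw [interp_app]
  refine gt_tup_args f ss (by rw [interpArgs_zero]; exact Gt.zero) (fun p => ?_) p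
  unfold interpArgs
  split_ifs
  exacts [.inr rfl, .inl rfl]

end

/-! ### Iterates that govern the fundamental sequence of an interpretation -/

/-- The starting point of the iteration in the fundamental sequence of an interpretation. -/
def base : RTerm ar Empty → OTerm (maxArity ar)
  | var _ => zero
  | app f ss => if ar f < maxArity ar then zero else tup (args f ss)

theorem base_app (f : Fin K) (ss : Fin (ar f) → RTerm ar Empty) :
    base (app f ss) = if ar f < maxArity ar then zero else tup (args f ss) := rfl

/-- The position before the one that is iterated in the fundamental sequence of
`I(f_j(s_1, …, s_m))`. -/
def crit (ar : Fin K → ℕ) (f : Fin K) : ℕ := min (ar f) (maxArity ar - 1)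

/-- A function whose iterations are dominated by the fundamental sequence of an
interpretation. -/
def nest (d : ℕ) : RTerm ar Empty → OTerm (maxArity ar) → OTerm (maxArity ar)
  | var y => y.elim
  | app f ss => stageTup (args f ss) (crit ar f) <|
      if crit ar f = 0 then ofNat f
      else if ar f < maxArity ar then args f ss (ar f)
      -- With `N` the maximal arity, here `ar f = N ≥ 2`, so this condition holds and the final
      -- default is never used. The immediate subterm with index `N - 2` sits at position `N - 1` of
      -- `ψ`.
      else if h : maxArity ar - 2 < ar f then
        (nest d (ss ⟨maxArity ar - 2, h⟩))^[2 * d - 1] (base (ss ⟨maxArity ar - 2, h⟩))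
      else zero

/-- A bound for the interpretations of the terms of depth less than `d` below a term. -/
def bound (d : ℕ) (s : RTerm ar Empty) : OTerm (maxArity ar) := (nest d s)^[2 * d - 1] (base s)

/-- The argument of `ψ` at the position `crit ar f` in `nest d (app f ss)`. -/
def pivot (d : ℕ) (f : Fin K) (ss : Fin (ar f) → RTerm ar Empty) : OTerm (maxArity ar) :=
  if crit ar f = 0 then ofNat f
  else if ar f < maxArity ar then args f ss (ar f)
  else if h : maxArity ar - 2 < ar f then bound d (ss ⟨maxArity ar - 2, h⟩)
  else zero

theorem nest_app (d : ℕ) (f : Fin K) (ss : Fin (ar f) → RTerm ar Empty) :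
    nest d (app f ss) = stageTup (args f ss) (crit ar f) (pivot d f ss) := rfl

theorem plain_base (s : RTerm ar Empty) : Plain (base s) := by
  cases s with
  | var y => exact y.elim
  | app f ss =>
    rw [base_app]
    split_ifs
    exacts [Plain.zero, plain_tup (plain_args f ss)]

theorem plain_nest (d : ℕ) (s : RTerm ar Empty) : ∀ z, Plain z → Plain (nest d s z) := by
  induction s with
  | var y => exact y.elim
  | app f ss ih =>
    intro z hz
    refine plain_stageTup (fun p _ => plain_args f ss p) ?_ hz
    split_ifs with h1 h2 h3
    exacts [plain_ofNat _, plain_args f ss _, plain_iterate (ih _) (plain_base _) _, Plain.zero]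

theorem plain_nest_iterate (d : ℕ) (s : RTerm ar Empty) (n : ℕ) :
    Plain ((nest d s)^[n] (base s)) := plain_iterate (plain_nest d s) (plain_base s) n

theorem plain_pivot (d : ℕ) (f : Fin K) (ss : Fin (ar f) → RTerm ar Empty) :
    Plain (pivot d f ss) := by
  unfold pivot
  split_ifs
  exacts [plain_ofNat _, plain_args f ss _, plain_nest_iterate _ _ _, Plain.zero]

theorem exists_nest_eq_psi (d : ℕ) (s : RTerm ar Empty) (z : OTerm (maxArity ar)) :
    ∃ b, nest d s z = psi b := by
  cases s with
  | var y => exact y.elim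
  | app f ss => exact ⟨_, rfl⟩

theorem exists_nest_iterate_eq_psi (d : ℕ) (s : RTerm ar Empty) {n : ℕ} (hn : 1 ≤ n)
    (z : OTerm (maxArity ar)) : ∃ b, (nest d s)^[n] z = psi b := by
  obtain ⟨n, rfl⟩ := Nat.exists_eq_add_of_le' hn
  rw [Function.iterate_succ_apply']
  exact exists_nest_eq_psi d s _

theorem pivot_of_ar_lt {d : ℕ} {f : Fin K} (ss : Fin (ar f) → RTerm ar Empty)
    (h : ar f < maxArity ar) : interpArgs f ss (ar f) = plus (pivot d f ss) one := by
  have hc : crit ar f = ar f := by unfold crit; omega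
  unfold pivot
  rw [hc, if_pos h]
  split_ifs with h0
  · rw [h0, interpArgs_zero, plus_ofNat_one]
  · exact interpArgs_ar f ss (by omega)

section
variable {x d : ℕ} (hN : 1 ≤ maxArity ar)
include hN

theorem crit_lt (f : Fin K) : crit ar f < maxArity ar := by unfold crit; omega

theorem nest_iterate_reduces (s : RTerm ar Empty) {m n : ℕ} (hmn : m ≤ n) :
    Reduces x ((nest d s)^[n] (base s)) ((nest d s)^[m] (base s)) := by
  cases s with
  | var y => exact y.elim
  | app f ss =>
    exact stageTup_iterate_reduces (crit_lt hN f) (fun p _ => plain_args f ss p)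
      (plain_pivot d f ss) (plain_base _) hmn

theorem nest_nest_reduces (hx : 1 ≤ x) (s : RTerm ar Empty) {z : OTerm (maxArity ar)}
    (hz : Plain z) (hne : z ≠ zero) :
    Reduces x (nest d s (nest d s z)) (nest d s (plus z one)) := by
  cases s with
  | var y => exact y.elim
  | app f ss =>
    exact stageTup_stageTup_reduces (crit_lt hN f) (fun p _ => plain_args f ss p)
      (plain_pivot d f ss) hx hz hne

theorem nest_reduces_plus_one (hx : 1 ≤ x) (s : RTerm ar Empty) {z : OTerm (maxArity ar)}
    (hz : Plain z) (hne : z ≠ zero) : Reduces x (nest d s z) (plus z one) := by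
  cases s with
  | var y => exact y.elim
  | app f ss =>
    have := tup_reduces_arg_plus_one hx (plain_stage (fun p _ => plain_args f ss p)
      (plain_pivot d f ss) hz) (p := crit ar f + 1) (crit_lt hN f) (by rwa [stage_succ])
    rwa [stage_succ] at this

/-- `bound` uses `2d - 1` iterates; one more application has it as an argument and so yields the
successor. -/
theorem nest_iterate_reduces_bound_plus_one (hd : 1 ≤ d) (hx : 2 * d ≤ x)
    (s : RTerm ar Empty) :
    Reduces x ((nest d s)^[x + 1] (base s)) (plus (bound d s) one) := by
  refine (nest_iterate_reduces hN s (m := (2 * d - 1) + 1) (by omega)).trans ?_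
  rw [Function.iterate_succ_apply']
  refine nest_reduces_plus_one hN (by omega) s (plain_nest_iterate d s _) ?_
  obtain ⟨b, hb⟩ := exists_nest_iterate_eq_psi d s (n := 2 * d - 1) (by omega) (base s)
  rw [hb]; simp [psi]

omit hN in
theorem crit_eq_of_lt {f : Fin K} (h : ar f < maxArity ar) : crit ar f = ar f := by
  unfold crit; omega

omit hN in
theorem pivot_eq_bound {f : Fin K} (ss : Fin (ar f) → RTerm ar Empty) (k : Fin (ar f))
    (hm : ar f = maxArity ar) (hk : k.1 + 2 = maxArity ar) : pivot d f ss = bound d (ss k) := by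
  unfold pivot
  rw [if_neg (by unfold crit; omega), if_neg (by omega), dif_pos (by omega)]
  congr 2
  exact Fin.ext (by simp; omega)

/-- Needed for the membership in `Fix` in `fund_interp_reduces`. Each iterate agrees with `I(s)`
before the position `crit` and is smaller there; at maximal arity at least `2` this uses the claim
for a subterm, at `2d - 1` iterates. -/
theorem gt_interp_nest_iterate (hd : 1 ≤ d) (s : RTerm ar Empty) (n : ℕ) :
    Gt (interp s).1 ((nest d s)^[n] (base s)) := by
  induction s generalizing n with
  | var y => exact y.elim
  | app f ss ih =>
    have hle := ar_le_maxArity (ar := ar) f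
    induction n with
    | zero =>
      rw [Function.iterate_zero_apply, base_app]
      split_ifs with h
      · rw [interp_app]; exact Gt.zero
      · have h' : ar f = maxArity ar := by omega
        have := gt_interp_args f ss
        rw [interp_app] at this ⊢
        refine gt_tup_tup hle (fun p _ => this p)
          (fun p hp => interpArgs_of_ne f ss hp.ne) ?_
        rw [interpArgs_ar f ss (by omega)]
        exact gt_plus_one _
    | succ n ihn =>
      rw [Function.iterate_succ_apply']
      generalize (nest d (app f ss))^[n] (base (app f ss)) = z at ihn
      rw [nest_app]
      have hargs := gt_interp_args f ss
      have hpiv : Gt (interp (app f ss)).1 (pivot d f ss) ∧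
          Gt (interpArgs f ss (crit ar f)) (pivot d f ss) := by
        by_cases hc : crit ar f = 0
        · rw [hc, interpArgs_zero, pivot, if_pos hc, interp_app]
          refine ⟨gt_tup_ofNat (by rw [interpArgs_zero]; exact Gt.zero) _, ?_⟩
          rw [← plus_ofNat_one]
          exact gt_plus_one _
        · by_cases hm : ar f < maxArity ar
          · rw [pivot, if_neg hc, if_pos hm, crit_eq_of_lt hm]
            refine ⟨hargs _, ?_⟩
            rw [interpArgs_ar f ss (by rw [crit_eq_of_lt hm] at hc; omega)]
            exact gt_plus_one _
          · have hk : maxArity ar - 2 < ar f := by unfold crit at hc; omega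
            have hce : crit ar f = maxArity ar - 2 + 1 := by unfold crit at hc ⊢; omega
            rw [pivot_eq_bound ss ⟨maxArity ar - 2, hk⟩ (by omega)
              (by simp; unfold crit at hc; omega)]
            have h1 := ih ⟨maxArity ar - 2, hk⟩ (2 * d - 1)
            rw [hce, interpArgs_of_ne f ss (by unfold crit at hc; omega),
              args_succ f ss ⟨_, hk⟩]
            refine ⟨?_, h1⟩
            obtain ⟨b, hb⟩ := exists_nest_iterate_eq_psi d (ss ⟨maxArity ar - 2, hk⟩)
              (n := 2 * d - 1) (by omega) (base _)
            rw [bound, hb, interp_app]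
            refine gt_tup_of_gt (p := maxArity ar - 2 + 1) (by omega) ?_
            rw [interpArgs_of_ne f ss (by unfold crit at hc; omega), args_succ f ss ⟨_, hk⟩, ← hb]
            exact h1
      rw [interp_app] at *
      refine gt_tup_tup (crit_lt hN f).le (fun p _ => ?_) (fun p hp => ?_) ?_
      · unfold stage
        split_ifs
        exacts [hargs p, hpiv.1, ihn, Gt.zero]
      · rw [interpArgs_of_ne f ss (by unfold crit at hp; omega), stage, if_pos hp]
      · rw [stage_self]; exact hpiv.2

end

theorem stageTup_congr {N : ℕ} {c d : ℕ → OTerm N} {i : ℕ} (h : ∀ p < i, c p = d p)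
    (v : OTerm N) : stageTup c i v = stageTup d i v := by
  funext z
  refine tup_congr fun p _ => ?_
  unfold stage
  split_ifs with h1
  exacts [h p h1, rfl, rfl, rfl]

section
variable {x d : ℕ} (hN : 1 ≤ maxArity ar)
include hN

omit hN in
theorem fund_interp_of_ar_lt (f : Fin K) (ss : Fin (ar f) → RTerm ar Empty)
    (hm : ar f < maxArity ar) :
    fund x (interp (app f ss)).1 = (nest d (app f ss))^[x + 1] (base (app f ss)) := by
  rw [interp_app, fund_tup_succ_zero hm (fun l hl _ => by
      rw [interpArgs_of_ne f ss hl.ne', args_of_lt f ss hl]) (pivot_of_ar_lt (d := d) ss hm) ?_,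
    nest_app, crit_eq_of_lt hm, base_app, if_pos hm]
  · rw [← stageTup_congr fun p hp => interpArgs_of_ne f ss hp.ne]
  · rw [interpArgs_of_ne f ss hm.ne', args_of_lt f ss hm]

omit hN in
theorem update_interpArgs_maxArity {f : Fin K} (ss : Fin (ar f) → RTerm ar Empty)
    (hm : ar f = maxArity ar) :
    tup (Function.update (interpArgs f ss) (maxArity ar) (args f ss (maxArity ar))) =
      tup (args f ss) := by
  refine tup_congr fun p _ => ?_
  rw [Function.update_apply]
  split_ifs with h
  · rw [h]
  · exact interpArgs_of_ne f ss (by omega)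

omit hN in
theorem fund_interp_of_maxArity_eq_one (f : Fin K) (ss : Fin (ar f) → RTerm ar Empty)
    (hm : ar f = maxArity ar) (h1 : maxArity ar = 1) :
    fund x (interp (app f ss)).1 = (nest d (app f ss))^[x + 1] (base (app f ss)) := by
  have hc : crit ar f = 0 := by unfold crit; omega
  rw [interp_app, fund_tup_succ_succ (i := 0) (v := ofNat f)
    (β := args f ss (maxArity ar)) (by omega) (fun l hl _ => by omega) ?_ ?_,
    update_interpArgs_maxArity ss hm, nest_app, hc, base_app, if_neg (by omega), pivot,
    if_pos hc]
  · rw [← stageTup_congr fun p hp => absurd hp (Nat.not_lt_zero p)]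
  · rw [interpArgs_zero, plus_ofNat_one]
  · exact interpArgs_of_eq f ss hm.symm (by omega)

/-- The fundamental sequence of an interpretation dominates the iterations of `nest`. -/
theorem fund_interp_reduces (hd : 1 ≤ d) (hx : 2 * d ≤ x) (s : RTerm ar Empty) :
    Plain (fund x (interp s).1) ∧
      Reduces x (fund x (interp s).1) ((nest d s)^[x + 1] (base s)) := by
  induction s with
  | var y => exact y.elim
  | app f ss ih =>
    have hle := ar_le_maxArity (ar := ar) f
    by_cases hm : ar f < maxArity ar
    · rw [fund_interp_of_ar_lt f ss hm (d := d)]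
      exact ⟨plain_nest_iterate d _ _, .refl⟩
    by_cases h1 : maxArity ar = 1
    · rw [fund_interp_of_maxArity_eq_one f ss (by omega) h1 (d := d)]
      exact ⟨plain_nest_iterate d _ _, .refl⟩
    obtain ⟨n, hn⟩ : ∃ n, maxArity ar = n + 2 := ⟨maxArity ar - 2, by omega⟩
    have hm' : ar f = maxArity ar := by omega
    have hc : crit ar f = n + 1 := by unfold crit; omega
    let k : Fin (ar f) := ⟨n, by omega⟩
    have hin : n + 1 < maxArity ar := by omega
    have hargs : args f ss (n + 1) = (interp (ss k)).1 := args_succ f ss k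
    have hint : interpArgs f ss (n + 1) = (interp (ss k)).1 := by
      rw [interpArgs_of_ne f ss (by omega), hargs]
    have hpiv : pivot d f ss = bound d (ss k) := pivot_eq_bound ss k hm' hn.symm
    obtain ⟨b, hb⟩ := exists_nest_iterate_eq_psi d (ss k) (n := 2 * d - 1) (by omega) (base _)
    change bound d (ss k) = psi b at hb
    have hgt : Gt (interp (ss k)).1 (psi b) := by
      rw [← hb]; exact gt_interp_nest_iterate hN hd (ss k) _
    have hgt' : Gt (interp (ss k)).1 (plus (psi b) one) := by
      obtain ⟨b', hb'⟩ := exists_interp_eq_psi (ss k)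
      rw [hb'] at hgt ⊢
      exact Gt.head hgt
    have hA : Plain (tup (args f ss)) := plain_tup (plain_args f ss)
    have hnsucc : ∀ g : Fin K, ∀ ts : Fin (ar g) → RTerm ar Empty,
        ¬ IsSucc (tup (args g ts)) ∧ ¬ IsSucc (tup (interpArgs g ts)) := fun g ts =>
      ⟨not_isSucc_psi (i := 0) (by simp [args_zero, ofNat_succ]),
        not_isSucc_psi (i := 0) (by simp [interpArgs_zero, ofNat_succ])⟩
    -- First fundamental step: position `N - 1` is a limit and position `N` a successor, so the
    -- former becomes its own `[x]` and the latter `ψ(args)`.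
    have hfund := fund_tup_limit_succ (x := x) (c := interpArgs f ss)
      (β := args f ss (maxArity ar)) hin (fun l hl hl' => by omega)
      (by rw [hint]; exact interp_ne_zero _) (by
        rw [hint]
        generalize ss k = s
        cases s with
        | var y => exact y.elim
        | app g ts => rw [interp_app]; exact (hnsucc g ts).2)
      (interpArgs_of_eq f ss hm'.symm (by omega))
    rw [update_interpArgs_maxArity ss hm', hint, ← interp_app] at hfund
    rw [hfund]
    obtain ⟨ih1, ih2⟩ := ih k
    have hp := plain_update (plain_update (plain_interpArgs f ss) (n + 1) ih1) (maxArity ar) hA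
    refine ⟨plain_tup hp, ?_⟩
    -- By induction the new entry at position `N - 1` descends to `bound + 1`, a successor on which
    -- the next fundamental step can act.
    set c := Function.update (Function.update (args f ss) (n + 1) (plus (bound d (ss k)) one))
      (maxArity ar) (tup (args f ss)) with hcdef
    have hcN : c (maxArity ar) = tup (args f ss) := by simp [hcdef]
    have hci : c (n + 1) = plus (psi b) one := by
      rw [hcdef, Function.update_of_ne hin.ne, Function.update_self, hb]
    have hclt : ∀ p < n + 1, c p = args f ss p := fun p hp' => by
      rw [hcdef, Function.update_of_ne (by omega), Function.update_of_ne (by omega)]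
    have hcp : ∀ p, Plain (c p) := plain_update (plain_update (plain_args f ss) _
      (plain_nest_iterate d (ss k) _).plus_one) _ hA
    have step : Reduces x (tup (Function.update (Function.update (interpArgs f ss) (n + 1)
        (fund x (interp (ss k)).1)) (maxArity ar) (tup (args f ss)))) (tup c) := by
      refine tup_mono hp fun p _ => ?_
      simp only [hcdef, Function.update_apply]
      split_ifs with h2 h3
      · exact .refl
      · exact ih2.trans (nest_iterate_reduces_bound_plus_one hN hd hx _)
      · exact interpArgs_reduces_args f ss p
    refine step.trans ?_
    have hA_gt := gt_tup_args f ss (c := args f ss) (by rw [args_zero]; exact Gt.zero)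
      fun p => .inl rfl
    -- `ψ(args)` still has the old entry `I(s_(N-1)) > bound + 1` at position `N - 1`, so its tuple
    -- is lexicographically larger.
    have hfix : FixPt (fun p : Fin (maxArity ar) => c p.1) (c (maxArity ar)) := by
      rw [hcN]
      refine ⟨_, rfl, ⟨⟨n + 1, hin⟩, fun l hl => ?_, ?_⟩, fun l => ?_⟩
      · exact (hclt l.1 hl).symm
      · change Gt (args f ss (n + 1)) (c (n + 1))
        rw [hci, hargs]
        exact hgt'
      · change Gt (tup (args f ss)) (c l.1)
        rcases Nat.lt_or_ge l.1 (n + 1) with h | h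
        · rw [hclt _ h]; exact hA_gt _
        · have : l.1 = n + 1 := by omega
          rw [this, hci]
          exact Gt.head (gt_tup_of_gt (p := n + 1) hin.le (by rw [hargs]; exact hgt))
    have hfund2 := fund_tup_succ_fixPt (x := x) hin (fun l hl hl' => by omega) hci
      (by rw [hcN]; exact tup_ne_zero _) (by rw [hcN]; exact (hnsucc f ss).1) hfix
    have heq : (nest d (app f ss))^[x + 1] (base (app f ss)) = fund x (tup c) := by
      rw [hfund2, nest_app, hc, base_app, if_neg hm, hcN, hpiv, hb]
      rw [← stageTup_congr hclt]
    rw [heq]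
    exact .single (red_fund_tup hcp (heq ▸ plain_nest_iterate d _ _))

theorem transGen_interp (hd : 1 ≤ d) (hx : 2 * d ≤ x) (s : RTerm ar Empty) {n : ℕ}
    (hn : n ≤ x + 1) {β : OTerm (maxArity ar)}
    (h : Reduces x ((nest d s)^[n] (base s)) β) :
    Relation.TransGen (Red x) (interp s).1 β := by
  obtain ⟨h1, h2⟩ := fund_interp_reduces hN hd hx s
  refine Relation.TransGen.head' ?_ (h2.trans ((nest_iterate_reduces hN s hn).trans h))
  cases s with
  | var y => exact y.elim
  | app f ss =>
    rw [interp_app] at h1 ⊢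
    exact red_fund_tup (plain_interpArgs f ss) h1

end

/-! ### Descent to subterms and to terms of depth zero -/

theorem interp_arg (x : ℕ) (f : Fin K) (ss : Fin (ar f) → RTerm ar Empty) (k : Fin (ar f)) :
    Relation.TransGen (Red x) (interp (app f ss)).1 (interp (ss k)).1 := by
  have hk : k.1 + 1 < maxArity ar + 1 := Nat.succ_lt_succ (k.2.trans_le (ar_le_maxArity f))
  have hne : interpArgs f ss (k + 1) ≠ zero := by
    unfold interpArgs
    rw [args_succ]
    split_ifs
    exacts [plus_one_ne_zero _, interp_ne_zero _]
  rw [interp_app, ← args_succ]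
  refine Relation.TransGen.head' (red_psi_arg (a := fun p => interpArgs f ss p.1)
    (fun _ => plain_interpArgs f ss _) (i := ⟨k + 1, hk⟩) hne) ?_
  exact ((plain_interpArgs f ss _).plus_ofNat_reduces_self x).trans
    (interpArgs_reduces_args f ss _)

theorem interp_vars (x : ℕ) (ρ : V → RTerm ar Empty) {s : RTerm ar V} {y : V} (hy : y ∈ s.vars) :
    Reduces x (interp (s.subst ρ)).1 (interp (ρ y)).1 := by
  induction s with
  | var z =>
    rw [vars, Set.mem_singleton_iff] at hy
    rw [subst, hy]
  | app f ss ih =>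
    rw [vars, Set.mem_iUnion] at hy
    obtain ⟨k, hk⟩ := hy
    rw [subst]
    exact (interp_arg x f _ k).to_reflTransGen.trans (ih k hk)

theorem const_reduces {x : ℕ} {N : ℕ} {c : ℕ → OTerm N} (hc : ∀ p, Plain (c p)) {n : ℕ}
    (h : Reduces x (c 0) (ofNat n)) :
    Reduces x (tup c) (tup fun p => if p = 0 then ofNat n else zero) := by
  refine tup_mono hc fun p _ => ?_
  split_ifs with hp
  · rwa [hp]
  · exact (hc p).reduces_zero

theorem interp_const {g : Fin K} (hg : ar g = 0) (ts : Fin (ar g) → RTerm ar Empty) :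
    (interp (app g ts)).1 = tup fun p => if p = 0 then ofNat (g + 1) else zero := by
  rw [interp_app]
  refine tup_congr fun p _ => ?_
  split_ifs with hp
  · rw [hp, interpArgs_zero]
  · rw [interpArgs_of_ne g ts (by omega), args_of_lt g ts (by omega)]

theorem ar_eq_zero_of_depth {g : Fin K} {ts : Fin (ar g) → RTerm ar V}
    (h : depth (app g ts) = 0) : ar g = 0 := by
  by_contra hne
  have := Finset.le_sup (f := fun i => (ts i).depth + 1)
    (Finset.mem_univ (⟨0, Nat.pos_of_ne_zero hne⟩ : Fin (ar g)))
  rw [depth] at h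
  omega

/-- Pointwise descent for right hand sides of depth `0`. -/
theorem transGen_of_lpo_of_depth_eq_zero (x : ℕ) (ρ : V → RTerm ar Empty) {s t : RTerm ar V}
    (h : LPO s t) (ht : t.depth = 0) :
    Relation.TransGen (Red x) (interp (s.subst ρ)).1 (interp (t.subst ρ)).1 := by
  induction h with
  | @var s y hy hne =>
    cases s with
    | var z => exact absurd (by rw [Set.mem_singleton_iff.mp hy]) hne
    | app f ss =>
      rw [vars, Set.mem_iUnion] at hy
      obtain ⟨k, hk⟩ := hy
      rw [subst]
      exact (interp_arg x f _ k).trans_left (interp_vars x ρ hk)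
  | subEq k h => rw [← h, subst]; exact interp_arg x _ _ k
  | subGt k _ ih => rw [subst]; exact (interp_arg x _ _ k).trans (ih ht)
  | @prec f g ss ts hgf _ _ =>
    have hg := ar_eq_zero_of_depth ht
    rw [subst, subst, interp_const hg, interp_app]
    set c := interpArgs f fun i => (ss i).subst ρ
    have hc : ∀ p, Plain (c p) := plain_interpArgs _ _
    have h0 : c 0 = plus (ofNat f) one := by rw [plus_ofNat_one]; exact interpArgs_zero _ _
    -- One step lowers the symbol from `f + 1` to `f`, which is still at least `g + 1`; the other
    -- arguments are then erased. This works for `x = 0` too.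
    have hred : Red x (c 0) (ofNat f) := by rw [h0]; exact (plain_ofNat _).red_plus_one
    have := Red.psi_update (fun p : Fin (maxArity ar + 1) => c p.1) (fun p => (hc _).nf) 0 hred
    refine Relation.TransGen.head' this ?_
    have hup : psi (Function.update (fun p : Fin (maxArity ar + 1) => c p.1) 0 (ofNat f)) =
        tup (Function.update c 0 (ofNat f)) := by
      refine congrArg psi (funext fun p => ?_)
      simp only [Function.update_apply, Fin.ext_iff, Fin.val_zero]
    rw [hup]
    refine const_reduces (plain_update hc 0 (plain_ofNat _)) ?_
    rw [Function.update_self]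
    exact ofNat_reduces hgf
  | lex i => have := ar_eq_zero_of_depth ht; exact absurd i.2 (by omega)

/-! ### Descent along the path order -/

section
variable {x d : ℕ} (hN : 1 ≤ maxArity ar)
include hN

omit hN in
theorem nest_reduces_const {f g : Fin K} (hgf : g < f) (hg : ar g = 0)
    (ss : Fin (ar f) → RTerm ar Empty) (ts : Fin (ar g) → RTerm ar Empty)
    {z : OTerm (maxArity ar)} (hz : Plain z) :
    Reduces x (nest d (app f ss) z) (interp (app g ts)).1 := by
  rw [interp_const hg, nest_app]
  refine const_reduces (plain_stage (fun p _ => plain_args f ss p) (plain_pivot d f ss) hz) ?_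
  unfold stage
  split_ifs with h1 h2 h3
  · rw [args_zero]; exact ofNat_reduces (Nat.succ_le_succ hgf.le)
  · rw [pivot, if_pos h2.symm]; exact ofNat_reduces hgf
  · omega
  · omega

omit hN in
/-- The last step of the descent to `I(t)`: all but the first arguments are bounded by `Y`. -/
theorem stageTup_reduces_interp {g : Fin K} (ts : Fin (ar g) → RTerm ar Empty) (hx : 1 ≤ x)
    {i : ℕ} (hi : i < ar g) {Y v : OTerm (maxArity ar)} (hY : Plain Y) (hne : Y ≠ zero)
    (hv : Plain v) {c : ℕ → OTerm (maxArity ar)} (hc : ∀ p, Plain (c p))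
    (hlt : ∀ p < i, c p = args g ts p) (hvi : Reduces x v (args g ts i))
    (hl : ∀ l, Reduces x Y (interp (ts l)).1) :
    Reduces x (stageTup c i v (plus Y one)) (interp (app g ts)).1 := by
  have hle := ar_le_maxArity (ar := ar) g
  rw [interp_app]
  refine (stageTup_reduces_spread hx hi hle hv hY hne hc).trans (tup_mono (fun p => ?_) ?_)
  · split_ifs
    exacts [hc p, hv, hY, hY.plus_one, Plain.zero]
  · intro p _
    split_ifs with h1 h2 h3 h4
    · rw [hlt p h1, interpArgs_of_ne g ts (by omega)]
    · rw [h2, interpArgs_of_ne g ts (by omega)]; exact hvi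
    · rw [interpArgs_of_ne g ts h3.ne]
      obtain ⟨l, rfl⟩ : ∃ l : Fin (ar g), p = l + 1 := ⟨⟨p - 1, by omega⟩, by simp; omega⟩
      rw [args_succ]; exact hl l
    · rw [interpArgs_of_eq g ts h4 (by omega)]
      obtain ⟨l, rfl⟩ : ∃ l : Fin (ar g), p = l + 1 := ⟨⟨p - 1, by omega⟩, by simp; omega⟩
      rw [args_succ]; exact (hl l).plus_one
    · rw [interpArgs_of_ne g ts h4, args_of_lt g ts (by omega)]

/-- All positions after `i` are erased except the one holding `Y + 1`. Lowering position `i` by one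
then moves `Y + 1` to position `i + 1`, from where it is spread over the arguments of `g`. -/
theorem nest_reduces_of_arg_drop {f g : Fin K} (ss : Fin (ar f) → RTerm ar Empty)
    (ts : Fin (ar g) → RTerm ar Empty) (hx : 1 ≤ x)
    {i : ℕ} (hi : i < ar g) (hic : i < crit ar f)
    {Y : OTerm (maxArity ar)} (hY : Plain Y) (hne : Y ≠ zero)
    (hlt : ∀ p < i, args f ss p = args g ts p)
    (hvi : Reduces x (args f ss i) (plus (args g ts i) one))
    (hl : ∀ l, Reduces x Y (interp (ts l)).1) :
    Reduces x (nest d (app f ss) (plus Y one)) (interp (app g ts)).1 := by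
  set v := args g ts i with hv
  have hvp : Plain v := plain_args g ts i
  set c : ℕ → OTerm (maxArity ar) := fun p =>
    if p < i then args f ss p else if p = i then plus v one
      else if p = crit ar f + 1 then plus Y one else zero with hc
  have hcp : ∀ p, Plain (c p) := fun p => by
    rw [hc]; dsimp only
    split_ifs
    exacts [plain_args f ss p, hvp.plus_one, hY.plus_one, Plain.zero]
  have hst := plain_stage (i := crit ar f) (fun p _ => plain_args f ss p) (plain_pivot d f ss)
    hY.plus_one
  have h1 : Reduces x (nest d (app f ss) (plus Y one)) (tup c) := by
    rw [nest_app]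
    refine tup_mono hst fun p _ => ?_
    by_cases hpi : p < i
    · have : stage (args f ss) (crit ar f) (pivot d f ss) (plus Y one) p = c p := by
        simp [stage, hc, hpi, hpi.trans hic]
      rw [this]
    · by_cases hpe : p = i
      · have h2 : stage (args f ss) (crit ar f) (pivot d f ss) (plus Y one) p = args f ss i := by
          simp [stage, hpe, hic]
        have h3 : c p = plus v one := by simp [hc, hpe]
        rw [h2, h3]; exact hvi
      · by_cases hpc : p = crit ar f + 1
        · rw [hpc, stage_succ]
          have : c (crit ar f + 1) = plus Y one := by
            simp only [hc]
            rw [if_neg (by omega), if_neg (by omega), if_pos trivial]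
          rw [this]
        · have : c p = zero := by simp [hc, hpi, hpe, hpc]
          rw [this]; exact (hst p).reduces_zero
  refine h1.trans ((tup_reduces_stageTup hx (q := crit ar f + 1) (by omega) (crit_lt hN f) hvp hY
    hne c hcp (by simp [hc]) ?_ fun l hil hlc => ?_).trans
    (stageTup_reduces_interp ts hx hi hY hne hvp hcp (fun p hp => ?_) .refl hl))
  · simp only [hc]
    rw [if_neg (by omega), if_neg (by omega), if_pos trivial]
  · simp only [hc]
    rw [if_neg (by omega), if_neg (by omega), if_neg hlc]
  · simp only [hc]
    rw [if_pos hp, hlt p hp]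

/-- The position that drops is `0`, which holds the symbol. If `crit` is `0`, it was already lowered
by the fundamental sequence. -/
theorem nest_reduces_of_prec {f g : Fin K} (hgf : g < f) (ss : Fin (ar f) → RTerm ar Empty)
    (ts : Fin (ar g) → RTerm ar Empty) (hx : 1 ≤ x) (hg : 0 < ar g)
    {Y : OTerm (maxArity ar)} (hY : Plain Y) (hne : Y ≠ zero)
    (hl : ∀ l, Reduces x Y (interp (ts l)).1) :
    Reduces x (nest d (app f ss) (plus Y one)) (interp (app g ts)).1 := by
  by_cases hc : crit ar f = 0
  · rw [nest_app, hc, pivot, if_pos hc]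
    exact stageTup_reduces_interp ts hx hg hY hne (plain_ofNat _) (plain_args f ss)
      (fun p hp => absurd hp (Nat.not_lt_zero p)) (ofNat_reduces hgf) hl
  · refine nest_reduces_of_arg_drop hN ss ts hx hg (Nat.pos_of_ne_zero hc) hY hne
      (fun p hp => absurd hp (Nat.not_lt_zero p)) ?_ hl
    rw [args_zero, args_zero, plus_ofNat_one]
    exact ofNat_reduces (Nat.succ_le_succ hgf)

omit hN in
theorem args_eq_of_lt {f : Fin K} (ss ts : Fin (ar f) → RTerm ar Empty) (i : Fin (ar f))
    (h : ∀ l < i, ss l = ts l) (p : ℕ) (hp : p < i + 1) : args f ss p = args f ts p := by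
  rcases p with _ | p
  · rfl
  · have hpi : p < i.1 := by omega
    have := h ⟨p, hpi.trans i.2⟩ hpi
    rw [show p = (⟨p, hpi.trans i.2⟩ : Fin (ar f)).1 from rfl, args_succ, args_succ, this]

/-- The first difference is at position `i + 1`. Before `crit` that position is dropped. At `crit`
the pivot itself must dominate: for non-maximal arity it is `I(s_i)`, set against the last entry
`I(t_i) + 1`; for maximal arity it is `bound`, set against `I(t_i)`. -/
theorem nest_reduces_of_lex {f : Fin K} (ss ts : Fin (ar f) → RTerm ar Empty) (i : Fin (ar f))
    (hx : 1 ≤ x) {Y : OTerm (maxArity ar)} (hY : Plain Y) (hne : Y ≠ zero)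
    (heq : ∀ l < i, ss l = ts l)
    (hred : Reduces x (interp (ss i)).1 (plus (interp (ts i)).1 one))
    (hbound : Reduces x (bound d (ss i)) (interp (ts i)).1)
    (hi : i + 1 < maxArity ar)
    (hl : ∀ l, Reduces x Y (interp (ts l)).1) :
    Reduces x (nest d (app f ss) (plus Y one)) (interp (app f ts)).1 := by
  have hargs := args_eq_of_lt ss ts i heq
  by_cases hic : i + 1 < crit ar f
  · refine nest_reduces_of_arg_drop hN ss ts hx (i := i + 1) (by unfold crit at hic; omega) hic hY
      hne hargs ?_ hl
    rwa [args_succ, args_succ]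
  have hc : crit ar f = i + 1 := by unfold crit at hic ⊢; omega
  have hle := ar_le_maxArity (ar := ar) f
  rw [nest_app, hc]
  by_cases hm : ar f < maxArity ar
  · have hi' : ar f = i + 1 := by rw [← hc, crit_eq_of_lt hm]
    have hp : pivot d f ss = (interp (ss i)).1 := by
      rw [pivot, if_neg (by omega), if_pos hm, ← args_succ]
      exact congrArg _ hi'
    rw [hp, interp_app]
    refine tup_mono (plain_stage (fun p _ => plain_args f ss p) (plain_interp _) hY.plus_one)
      fun p _ => ?_
    unfold stage
    split_ifs with h1 h2 h3
    · rw [hargs p h1, interpArgs_of_ne f ts (by omega)]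
    · rw [interpArgs_of_eq f ts (by omega) (by omega), h2, args_succ]; exact hred
    · rw [interpArgs_of_ne f ts (by omega), args_of_lt f ts (by omega)]
      exact hY.plus_one.reduces_zero
    · rw [interpArgs_of_ne f ts (by omega), args_of_lt f ts (by omega)]
  · have hi2 : i.1 + 2 = maxArity ar := by unfold crit at hc; omega
    rw [pivot_eq_bound ss i (by omega) hi2]
    refine stageTup_reduces_interp ts hx (by omega) hY hne (plain_nest_iterate d _ _)
      (plain_args f ss) hargs ?_ hl
    rwa [args_succ]

/-- A difference at position `N` is invisible to `nest`, but `base` retains the last argument. -/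
theorem base_reduces_of_lex {f : Fin K} (ss ts : Fin (ar f) → RTerm ar Empty) (i : Fin (ar f))
    (heq : ∀ l < i, ss l = ts l)
    (hred : Reduces x (interp (ss i)).1 (plus (interp (ts i)).1 one))
    (hi : i + 1 = maxArity ar) :
    Reduces x (base (app f ss)) (interp (app f ts)).1 := by
  have hle := ar_le_maxArity (ar := ar) f
  rw [base_app, if_neg (by omega), interp_app]
  refine tup_mono (plain_args f ss) fun p hp => ?_
  rcases Nat.lt_or_ge p (i + 1) with h | h
  · rw [args_eq_of_lt ss ts i heq p h, interpArgs_of_ne f ts (by omega)]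
  · obtain rfl : p = i + 1 := by omega
    rw [interpArgs_of_eq f ts (by omega) (by omega), args_succ, args_succ]
    exact hred

/-- Below maximal arity every argument is an entry of `nest`. At maximal arity some are lost there,
but the iterates descend to `base`, which contains them all. -/
theorem nest_iterate_reduces_arg {f : Fin K} (ss : Fin (ar f) → RTerm ar Empty) (k : Fin (ar f))
    (n : ℕ) :
    Reduces x ((nest d (app f ss))^[n + 1] (base (app f ss))) (interp (ss k)).1 := by
  have hk := k.2
  have hle := ar_le_maxArity (ar := ar) f
  rw [← args_succ]
  by_cases hm : ar f < maxArity ar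
  · rw [Function.iterate_succ_apply', nest_app]
    have := tup_reduces_arg (x := x) (plain_stage (i := crit ar f) (fun p _ => plain_args f ss p)
      (plain_pivot d f ss) (plain_nest_iterate d (app f ss) n)) (p := k + 1) (by omega)
    refine this.trans ?_
    unfold stage
    have hc := crit_eq_of_lt hm
    split_ifs with h1 h2 h3
    · exact .refl
    · rw [pivot, if_neg (by omega), if_pos hm, show args f ss (ar f) = args f ss (k + 1) from
        congrArg _ (by omega)]
    · omega
    · omega
  · refine (nest_iterate_reduces hN _ (Nat.zero_le _)).trans ?_
    rw [Function.iterate_zero_apply, base_app, if_neg hm]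
    exact tup_reduces_arg (plain_args f ss) (by omega)

/-- Induction on the path order. The depth bound `e` varies while `d` stays fixed, because `nest`
depends on `d`: the arguments of `t` are reached with `e - 1`, leaving two iterates to assemble `t`.
-/
theorem nest_iterate_reduces_of_lpo (hd : 1 ≤ d) (hx : 2 * d ≤ x) (ρ : V → RTerm ar Empty)
    {s t : RTerm ar V} (h : LPO s t) {e : ℕ} (he : e ≤ d) (ht : t.depth ≤ e) :
    Reduces x ((nest d (s.subst ρ))^[2 * e + 1] (base (s.subst ρ))) (interp (t.subst ρ)).1 := by
  induction h generalizing e with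
  | @var s y hy hne =>
    cases s with
    | var z => exact absurd (by rw [Set.mem_singleton_iff.mp hy]) hne
    | app f ss =>
      rw [vars, Set.mem_iUnion] at hy
      obtain ⟨k, hk⟩ := hy
      rw [subst]
      exact (nest_iterate_reduces_arg hN _ k _).trans (interp_vars x ρ hk)
  | subEq k h => rw [← h, subst]; exact nest_iterate_reduces_arg hN _ k _
  | subGt k _ ih =>
    rw [subst]
    exact (nest_iterate_reduces_arg hN _ k _).trans
      (transGen_interp hN hd hx _ (by omega) (ih he ht)).to_reflTransGen
  | @prec f g ss ts hgf _ ih =>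
    rw [subst, subst]
    rcases Nat.eq_zero_or_pos (ar g) with hg | hg
    · rw [Function.iterate_succ_apply']
      exact nest_reduces_const hgf hg _ _ (plain_nest_iterate d _ _)
    have hdep : ∀ l, (ts l).depth + 1 ≤ e := fun l =>
      (Finset.le_sup (f := fun i => (ts i).depth + 1) (Finset.mem_univ l)).trans ht
    obtain ⟨e, rfl⟩ := Nat.exists_eq_add_of_le' (Nat.le_of_add_left_le (hdep ⟨0, hg⟩))
    have hY := fun l => ih l (e := e) (by omega) (by have := hdep l; omega)
    rw [subst] at hY
    obtain ⟨b, hb⟩ := exists_nest_iterate_eq_psi d (app f fun i => (ss i).subst ρ)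
      (n := 2 * e + 1) (by omega)
        (base (app f fun i => (ss i).subst ρ))
    have hne : (nest d (app f fun i => (ss i).subst ρ))^[2 * e + 1]
          (base (app f fun i => (ss i).subst ρ)) ≠ zero := by
      rw [hb]; simp [psi]
    have hp := plain_nest_iterate d (app f fun i => (ss i).subst ρ) (2 * e + 1)
    rw [show 2 * (e + 1) + 1 = 2 * e + 1 + 1 + 1 by ring, Function.iterate_succ_apply',
      Function.iterate_succ_apply']
    exact (nest_nest_reduces hN (by omega) _ hp hne).trans
      (nest_reduces_of_prec hN hgf _ _ (by omega) hg hp hne hY)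
  | @lex f ss ts i _ heq _ ih ihi =>
    rw [subst, subst]
    have hdep : ∀ l, (ts l).depth + 1 ≤ e := fun l =>
      (Finset.le_sup (f := fun i => (ts i).depth + 1) (Finset.mem_univ l)).trans ht
    obtain ⟨e, rfl⟩ := Nat.exists_eq_add_of_le' (Nat.le_of_add_left_le (hdep i))
    have hY := fun l => ih l (e := e) (by omega) (by have := hdep l; omega)
    rw [subst] at hY
    obtain ⟨d, rfl⟩ := Nat.exists_eq_add_of_le' hd
    -- The largest admissible depth is used here, not `e`: `bound (d + 1)` consists of `2d + 1`
    -- iterates.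
    have hbound : Reduces x (bound (d + 1) ((ss i).subst ρ)) (interp ((ts i).subst ρ)).1 :=
      ihi (e := d) (by omega) (by have := hdep i; omega)
    have hred : Reduces x (interp ((ss i).subst ρ)).1
        (plus (interp ((ts i).subst ρ)).1 one) :=
      (transGen_interp hN hd hx _ le_rfl
        ((nest_iterate_reduces_bound_plus_one hN hd hx _).trans
          hbound.plus_one)).to_reflTransGen
    have heq' : ∀ l < i, (ss l).subst ρ = (ts l).subst ρ := fun l hl => by rw [heq l hl]
    have hle := ar_le_maxArity (ar := ar) f
    rcases Nat.lt_or_ge (i + 1) (maxArity ar) with hi | hi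
    · obtain ⟨b, hb⟩ := exists_nest_iterate_eq_psi (d + 1) (app f fun i => (ss i).subst ρ)
        (n := 2 * e + 1) (by omega)
        (base (app f fun i => (ss i).subst ρ))
      have hne : (nest (d + 1) (app f fun i => (ss i).subst ρ))^[2 * e + 1]
          (base (app f fun i => (ss i).subst ρ)) ≠ zero := by
        rw [hb]; simp [psi]
      have hp := plain_nest_iterate (d + 1) (app f fun i => (ss i).subst ρ) (2 * e + 1)
      rw [show 2 * (e + 1) + 1 = 2 * e + 1 + 1 + 1 by ring, Function.iterate_succ_apply',
        Function.iterate_succ_apply']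
      exact (nest_nest_reduces hN (by omega) _ hp hne).trans
        (nest_reduces_of_lex hN _ _ i (by omega) hp hne heq' hred hbound hi hY)
    · refine (nest_iterate_reduces hN _ (Nat.zero_le _)).trans ?_
      exact base_reduces_of_lex hN _ _ i heq' hred (by omega)

end

/-- Pointwise descent along the lexicographic path order. -/
theorem transGen_of_lpo {d : ℕ} (ρ : V → RTerm ar Empty) {s t : RTerm ar V} (h : LPO s t)
    (ht : t.depth ≤ d) :
    Relation.TransGen (Red (2 * d)) (interp (s.subst ρ)).1 (interp (t.subst ρ)).1 := by
  -- Depth `0` is separate since the iterates need `d ≥ 1`. Positive depth forces `d ≥ 1` and a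
  -- symbol of positive arity.
  rcases Nat.eq_zero_or_pos t.depth with h0 | h0
  · exact transGen_of_lpo_of_depth_eq_zero _ ρ h h0
  · have hN : 1 ≤ maxArity ar := by
      cases t with
      | var y => simp [depth] at h0
      | app g ts =>
        by_contra hN
        have hg := ar_le_maxArity (ar := ar) g
        have : IsEmpty (Fin (ar g)) := ⟨fun i => by have := i.2; omega⟩
        simp [depth] at h0
    exact transGen_interp hN (Nat.le_trans h0 ht) le_rfl _ (n := 2 * d + 1) le_rfl
      (nest_iterate_reduces_of_lpo hN (Nat.le_trans h0 ht) le_rfl ρ h le_rfl ht)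

/-! ### Closure under substitutions and contexts -/

theorem subst_subst {W U : Type*} (σ : V → RTerm ar W) (ρ : W → RTerm ar U) (s : RTerm ar V) :
    (s.subst σ).subst ρ = s.subst fun y => (σ y).subst ρ := by
  induction s with
  | var y => rfl
  | app f ss ih => simp only [subst, ih]

/-- Descent is pointwise, so it passes to an argument of `ψ`; for the last argument it must also
pass through `+ 1`, which is what `Red` guarantees. -/
theorem transGen_interp_update {x : ℕ} {f : Fin K} (ss : Fin (ar f) → RTerm ar Empty)
    (i : Fin (ar f)) {t : RTerm ar Empty}
    (h : Relation.TransGen (Red x) (interp (ss i)).1 (interp t).1) :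
    Relation.TransGen (Red x) (interp (app f ss)).1
      (interp (app f (Function.update ss i t))).1 := by
  have hle := ar_le_maxArity (ar := ar) f
  have key : Relation.TransGen (Red x) (interpArgs f ss (i + 1))
      (interpArgs f (Function.update ss i t) (i + 1)) := by
    unfold interpArgs
    rw [args_succ, args_succ, Function.update_self]
    split_ifs
    · exact Relation.TransGen.lift (plus · one) (fun _ _ => Red.plus_one) _ _ h
    · exact h
  have hne : ∀ p : ℕ, p ≠ i + 1 →
      interpArgs f (Function.update ss i t) p = interpArgs f ss p := by
    intro p hp
    unfold interpArgs
    have : args f (Function.update ss i t) p = args f ss p := by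
      rcases args_cases (ar := ar) f p with rfl | ⟨k, rfl⟩ | h'
      · rfl
      · rw [args_succ, args_succ, Function.update_of_ne (by rintro rfl; exact hp rfl)]
      · rw [args_of_lt _ _ h', args_of_lt _ _ h']
    rw [this]
  let q : Fin (maxArity ar + 1) := ⟨i + 1, by omega⟩
  let a : Fin (maxArity ar + 1) → OTerm (maxArity ar) := fun p => interpArgs f ss p.1
  have ha : ∀ p, NF (a p) := fun p => (plain_interpArgs f ss p.1).nf
  have lift : ∀ {α β}, NF α → Relation.TransGen (Red x) α β →
      Relation.TransGen (Red x) (psi (Function.update a q α)) (psi (Function.update a q β)) := by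
    intro α β hα h
    refine Relation.TransGen.lift (fun z => psi (Function.update a q z)) (fun γ δ hγ => ?_) _ _ h
    have := Red.psi_update (x := x) (β := δ) (Function.update a q γ) (fun p => ?_) q
      (by rwa [Function.update_self])
    · rwa [Function.update_idem] at this
    · rw [Function.update_apply]; split_ifs
      exacts [hγ.1, ha p]
  have := lift (ha q) key
  rw [Function.update_eq_self] at this
  rw [interp_app, interp_app]
  convert this using 1
  · rfl
  refine congrArg psi (funext fun p => ?_)
  rw [Function.update_apply]
  split_ifs with hp
  · rw [hp]
  · exact hne _ fun h' => hp (Fin.ext h')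

theorem subst_app_update {W : Type*} (σ : V → RTerm ar W) (f : Fin K) (ss : Fin (ar f) → RTerm ar V)
    (i : Fin (ar f)) (t : RTerm ar V) :
    (app f (Function.update ss i t)).subst σ =
      app f (Function.update (fun l => (ss l).subst σ) i (t.subst σ)) := by
  rw [subst]
  congr 1
  funext l
  by_cases hl : l = i
  · subst hl; simp
  · simp [hl]

/-- The path order is used for the rules only, so the depth of their right hand sides alone
determines `x`; a substitution applied to a rewrite step is absorbed into `ρ`. -/
theorem transGen_of_rew {R : Finset (RTerm ar V × RTerm ar V)}
    (hR : ∀ l r, (l, r) ∈ R → LPO l r) {s t : RTerm ar V} (h : Rew R s t)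
    (ρ : V → RTerm ar Empty) :
    Relation.TransGen (Red (2 * maxRhsDepth R)) (interp (s.subst ρ)).1
      (interp (t.subst ρ)).1 := by
  induction h generalizing ρ with
  | @rule l r hlr =>
    exact transGen_of_lpo ρ (hR l r hlr) (Finset.le_sup (f := fun p => p.2.depth) hlr)
  | subst σ _ ih => rw [subst_subst, subst_subst]; exact ih _
  | ctx ss i _ ih =>
    rw [subst_app_update]
    exact transGen_interp_update (fun l => (ss l).subst ρ) i (ih ρ)

end RTerm

theorem OrdTerm.descends_of_transGen {N x : ℕ} {α β : OTerm N}
    (h : Relation.TransGen (OTerm.Red x) α β) (hα : α.NF) (hβ : β.NF) :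
    OrdTerm.Descends x ⟨α, hα⟩ ⟨β, hβ⟩ := by
  induction h with
  | single h => exact .single h.genMem
  | tail _ h ih => exact (ih h.1).tail h.genMem

theorem theoremt {K : ℕ} (ar : Fin K → ℕ) (_hconst : ∃ c, ar c = 0) {V : Type*}
    (R : Finset (RTerm ar V × RTerm ar V))
    (hR : ∀ s t : RTerm ar V, RTerm.Rew R s t → RTerm.LPO s t) :
    ∃ k : ℕ, k = 2 * RTerm.maxRhsDepth R ∧
      ∀ l r : RTerm ar V, RTerm.Rew R l r → ∀ ρ : V → RTerm ar Empty,
        OrdTerm.Descends k (l.subst ρ).interp (r.subst ρ).interp :=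
  ⟨_, rfl, fun _ _ h ρ => OrdTerm.descends_of_transGen
    (RTerm.transGen_of_rew (fun l r hlr => hR l r (.rule hlr)) h ρ) _ _⟩
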